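/- **Setting.** The programming language is a call-by-value, ML-like language with recursive closures, pairs, sums, integers, Booleans, higher-order references, and discrete uniform sampling $\mathsf{rand}\,N$ from $\{0,\dots,N\}$. A *presampling tape* with label $\iota$ is a part of the program state that holds a bound $N$ and a finite list of values in $\{0,\dots,N\}$; the labelled operation $\mathsf{rand}\,N\,\iota$ removes and returns the first element of the tape $\iota$ if this tape is not empty (and has bound $N$), and samples uniformly otherwise. No instruction writes to a tape. The semantics is a Markov chain on configurations (expression, state) whose final states are the values. For a state $m$ of a Markov chain with final states, $\mathrm{exec}_\Downarrow(m)$ denotes the probability of reaching a final state from $m$. The refinement logic is a step-indexed separation logic (Iris-style: later modality $\triangleright$, persistence $\square$, user-chosen ghost state, invariants, fancy updates with masks) over a Markov chain called the *model*. The assertion $\mathsf{spec}(m)$ says that the model is in state $m$, and $\iota\hookrightarrow(N,\vec k)$ is ownership of the tape $\iota$ with bound $N$ and contents $\vec k$. The refinement weakest precondition $\mathsf{rwp}\,e\,\{\Phi\}$ is the least fixed point saying that $e$ is a value satisfying $\Phi$ or that, given the authoritative views of the current model state $m$ and program state $\sigma$, the *coupling precondition* holds for $m$ and $(e,\sigma)$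 and re-establishes, after the step, the views of the new states and the weakest precondition of the new expression. The coupling precondition is the least relation closed under: a program step; a model step coupled with a program step, the rest holding under $\triangleright$; a model step alone, the rest holding under $\triangleright$; a model step coupled with presampling uniform values onto finitely many existing tapes, the rest holding under $\triangleright$. Couplings are left-partial (the first marginal is exact, the second one is bounded above). Hoare triples are $\{P\}\,e\,\{v.\,Q\} := \square(P \mathrel{-\!\!*} \mathsf{rwp}\,e\,\{v.\,Q\})$, and $\vdash$ is entailment in the logic. The Galton–Watson sampler, for a value $d$ (a function that returns the number of children of a node), is - $\mathsf{rec}\ \mathsf{sampleNode}\;d\;r\;s\;() = \mathsf{let}\ n = d\,()\ \mathsf{in}\ \mathsf{let}\ f = (\lambda\_.\ \mathsf{let}\ r' = \mathsf{ref}\,[]\ \mathsf{in}\ \mathsf{Stack.add}\,(\mathsf{sampleNode}\;d\;r'\;s)\;s;\ r')\ \mathsf{in}\ r \leftarrow \mathsf{List.init}\;n\;f$; - $\mathsf{rec}\ \mathsf{run}\;s = \mathsf{match}\ \mathsf{Stack.take}\;s\ \mathsf{with}\ \mathsf{Some}\,f \Rightarrow f\,();\ \mathsf{run}\;s \mid \mathsf{None}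 \Rightarrow ()$; - $\mathsf{genTree} = \lambda d.\ \mathsf{let}\ r = \mathsf{ref}\,[]\ \mathsf{in}\ \mathsf{let}\ s = \mathsf{Stack.create}\,()\ \mathsf{in}\ \mathsf{Stack.add}\,(\mathsf{sampleNode}\;d\;r\;s)\;s;\ \mathsf{run}\;s;\ {!r}$, where a stack is a reference to a list and $\mathsf{List.init}\;n\;f=[f\,0,\dots,f\,(n-1)]$. **Theorem.** Let $N\in\mathbb N$, let $\mu$ be the uniform distribution on $\{0,\dots,N\}$, let $\iota$ be a tape label and $d$ a value. Let the model be the random walk on $\mathbb N$ that goes from $n+1$ to $n+k$ with probability $\mu(k)$ and stops at $0$. Let $S_d$ denote the specification $$\forall k\in\{0,\dots,N\}.\ \{\iota\hookrightarrow(N,[k])\}\ d\,()\ \{v.\ v=k * \iota\hookrightarrow(N,[])\},$$ which says that $d$ reads its value from the tape $\iota$. 1. In the logic, $$S_d\ \vdash\ \{\mathsf{spec}(1) * \iota\hookrightarrow(N,[])\}\ \mathsf{genTree}\;d\ \{\mathsf{True}\}.$$ 2. Consequently $\mathsf{genTree}\;d$ is a termination-preserving refinement of the random walk: if $\vdash S_d$,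 then for every program state $\sigma$ in which $\iota$ is an empty tape with bound $N$, $$\mathrm{exec}_\Downarrow(1)\ \le\ \mathrm{exec}_\Downarrow(\mathsf{genTree}\;d,\ \sigma).$$ -/

import Mathlib

open scoped ENNReal

namespace GWLogic

/-! ## Discrete sub-distributions, Markov chains, couplings -/

/-- A discrete probability sub-distribution. -/
@[ext] structure SubDist (A : Type) where
  mass : A → ℝ≥0∞
  le_one : ∑' a, mass a ≤ 1

namespace SubDist

variable {A B : Type}

/-- The everywhere-zero sub-distribution. -/
def zero : SubDist A := ⟨fun _ => 0, by simp⟩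

open Classical in
/-- The Dirac distribution. -/
noncomputable def ret (a : A) : SubDist A :=
  ⟨fun a' => if a' = a then 1 else 0, by rw [tsum_ite_eq]⟩

/-- Monadic bind. -/
noncomputable def bind (μ : SubDist A) (f : A → SubDist B) : SubDist B :=
  ⟨fun b => ∑' a, μ.mass a * (f a).mass b, by
    rw [ENNReal.tsum_comm]
    refine le_trans (ENNReal.tsum_le_tsum fun a => ?_) μ.le_one
    rw [ENNReal.tsum_mul_left]
    exact mul_le_of_le_one_right zero_le (f a).le_one⟩

/-- Push-forward along a function. -/
noncomputable def map (f : A → B) (μ : SubDist A) : SubDist B := μ.bind fun a => ret (f a)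

/-- The uniform distribution on `{0, …, N}`. -/
noncomputable def unif (N : ℕ) : SubDist (Fin (N + 1)) :=
  ⟨fun _ => ((N + 1 : ℕ) : ℝ≥0∞)⁻¹, by
    rw [tsum_fintype, Finset.sum_const, Finset.card_univ, Fintype.card_fin, nsmul_eq_mul]
    exact ENNReal.mul_inv_le_one _⟩

/-- There is a left-partial `R`-coupling of `μ₁` and `μ₂`. -/
def Coupled (μ₁ : SubDist A) (μ₂ : SubDist B) (R : A → B → Prop) : Prop :=
  ∃ μ : SubDist (A × B),
    (∀ a, ∑' b, μ.mass (a, b) = μ₁.mass a) ∧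
    (∀ b, ∑' a, μ.mass (a, b) ≤ μ₂.mass b) ∧
    ∀ a b, 0 < μ.mass (a, b) → R a b

end SubDist

/-- A discrete-time (sub-)Markov chain with a predicate singling out final states. -/
structure MarkovChain where
  State : Type
  step : State → SubDist State
  final : State → Prop
  final_step : ∀ m, final m → ∀ m', (step m).mass m' = 0

namespace MarkovChain

variable (C : MarkovChain)

/-- A state is reducible if it has a transition of positive probability. -/
def Red (m : C.State) : Prop := ∃ m', 0 < (C.step m).mass m'

open Classical in
/-- `execN n m` is the sub-distribution of the final states reached from `m` in at most
`n` steps. -/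
noncomputable def execN : ℕ → C.State → SubDist C.State
  | 0, m => if C.final m then SubDist.ret m else SubDist.zero
  | n + 1, m => if C.final m then SubDist.ret m else (C.step m).bind (execN n)

/-- The probability of reaching the final state `m'` from `m`. As `execN` is monotone in the
number of steps, the limit of the approximations is their supremum. -/
noncomputable def exec (m m' : C.State) : ℝ≥0∞ := ⨆ n, (C.execN n m).mass m'

/-- The probability that the execution from `m` terminates. -/
noncomputable def execTerm (m : C.State) : ℝ≥0∞ := ∑' m', C.exec m m'

end MarkovChain

/-! ## The programming language -/

inductive UnOp where
  | not | neg
  deriving DecidableEq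

inductive BinOp where
  | add | sub | mul | and | or | eq | le | lt
  deriving DecidableEq

/-- Literals: integers, Booleans, the unit value, heap locations, tape labels. -/
inductive Lit where
  | int (z : ℤ)
  | bool (b : Bool)
  | unit
  | loc (l : ℕ)
  | lbl (ι : ℕ)
  deriving DecidableEq

/-- A binder is a variable name or anonymous. -/
abbrev Binder := Option ℕ

mutual

inductive Val where
  | lit (l : Lit)
  | recV (f x : Binder) (e : Expr)
  | pairV (v₁ v₂ : Val)
  | inlV (v : Val)
  | inrV (v : Val)

/-- Expressions. The recursive function `rec f x = e` is an expression that evaluates to the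
closure `recV f x e`; values are closed and are left alone by substitution. -/
inductive Expr where
  | val (v : Val)
  | var (x : ℕ)
  | fn (f x : Binder) (e : Expr)
  | app (e₁ e₂ : Expr)
  | unop (op : UnOp) (e : Expr)
  | binop (op : BinOp) (e₁ e₂ : Expr)
  | ite (e e₁ e₂ : Expr)
  | pair (e₁ e₂ : Expr)
  | fst (e : Expr)
  | snd (e : Expr)
  | inl (e : Expr)
  | inr (e : Expr)
  | case (e : Expr) (x : Binder) (e₁ : Expr) (y : Binder) (e₂ : Expr)
  | alloc (e : Expr)
  | load (e : Expr)
  | store (e₁ e₂ : Expr)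
  | allocTape (e : Expr)
  | rand (e : Expr)
  | randT (e₁ e₂ : Expr)

end

/-- The value of an expression that is a value. -/
def Expr.toVal : Expr → Option Val
  | .val v => some v
  | _ => none

/-- Substitution of the (closed) value `v` for the variable `x`. -/
def Expr.subst (x : ℕ) (v : Val) : Expr → Expr
  | .val w => .val w
  | .var y => if y = x then .val v else .var y
  | .fn f y e => .fn f y (if f = some x ∨ y = some x then e else e.subst x v)
  | .app e₁ e₂ => .app (e₁.subst x v) (e₂.subst x v)
  | .unop op e => .unop op (e.subst x v)
  | .binop op e₁ e₂ => .binop op (e₁.subst x v) (e₂.subst x v)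
  | .ite e e₁ e₂ => .ite (e.subst x v) (e₁.subst x v) (e₂.subst x v)
  | .pair e₁ e₂ => .pair (e₁.subst x v) (e₂.subst x v)
  | .fst e => .fst (e.subst x v)
  | .snd e => .snd (e.subst x v)
  | .inl e => .inl (e.subst x v)
  | .inr e => .inr (e.subst x v)
  | .case e y e₁ z e₂ =>
      .case (e.subst x v) y (if y = some x then e₁ else e₁.subst x v)
        z (if z = some x then e₂ else e₂.subst x v)
  | .alloc e => .alloc (e.subst x v)
  | .load e => .load (e.subst x v)
  | .store e₁ e₂ => .store (e₁.subst x v) (e₂.subst x v)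
  | .allocTape e => .allocTape (e.subst x v)
  | .rand e => .rand (e.subst x v)
  | .randT e₁ e₂ => .randT (e₁.subst x v) (e₂.subst x v)

/-- Substitution for a binder. -/
def Expr.substB (b : Binder) (v : Val) (e : Expr) : Expr :=
  match b with
  | none => e
  | some x => e.subst x v

/-- One layer of an evaluation context; evaluation is call-by-value, right to left. -/
inductive Frame where
  | appR (e₁ : Expr)
  | appL (v₂ : Val)
  | unop (op : UnOp)
  | binopR (op : BinOp) (e₁ : Expr)
  | binopL (op : BinOp) (v₂ : Val)
  | ite (e₁ e₂ : Expr)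
  | pairR (e₁ : Expr)
  | pairL (v₂ : Val)
  | fst
  | snd
  | inl
  | inr
  | case (x : Binder) (e₁ : Expr) (y : Binder) (e₂ : Expr)
  | alloc
  | load
  | storeR (e₁ : Expr)
  | storeL (v₂ : Val)
  | allocTape
  | rand
  | randR (e₁ : Expr)
  | randL (v₂ : Val)

/-- Plugging an expression into a frame. -/
def Frame.fill : Frame → Expr → Expr
  | .appR e₁, e => .app e₁ e
  | .appL v₂, e => .app e (.val v₂)
  | .unop op, e => .unop op e
  | .binopR op e₁, e => .binop op e₁ e
  | .binopL op v₂, e => .binop op e (.val v₂)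
  | .ite e₁ e₂, e => .ite e e₁ e₂
  | .pairR e₁, e => .pair e₁ e
  | .pairL v₂, e => .pair e (.val v₂)
  | .fst, e => .fst e
  | .snd, e => .snd e
  | .inl, e => .inl e
  | .inr, e => .inr e
  | .case x e₁ y e₂, e => .case e x e₁ y e₂
  | .alloc, e => .alloc e
  | .load, e => .load e
  | .storeR e₁, e => .store e₁ e
  | .storeL v₂, e => .store e (.val v₂)
  | .allocTape, e => .allocTape e
  | .rand, e => .rand e
  | .randR e₁, e => .randT e₁ e
  | .randL v₂, e => .randT e (.val v₂)

/-- Evaluation contexts, outermost frame first. -/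
abbrev Ectx := List Frame

/-- `fill K e` is `K[e]`. -/
def Ectx.fill (K : Ectx) (e : Expr) : Expr := K.foldr Frame.fill e

/-- Extend a decomposition by an outer frame. -/
def Frame.push (F : Frame) (p : Ectx × Expr) : Ectx × Expr := (F :: p.1, p.2)

/-- Decomposition of a unary construct: either the operand `e` still has to be evaluated, in
the frame `F`, or the whole expression is the next redex. -/
def decomp₁ (F : Frame) (e : Expr) (rec_e : Ectx × Expr) : Ectx × Expr :=
  match e.toVal with
  | none => F.push rec_e
  | some _ => ([], F.fill e)

/-- Decomposition of a binary construct, whose right operand is evaluated first. -/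
def decomp₂ (FR : Expr → Frame) (FL : Val → Frame) (e₁ e₂ : Expr)
    (rec₁ rec₂ : Ectx × Expr) : Ectx × Expr :=
  match e₂.toVal with
  | none => (FR e₁).push rec₂
  | some v₂ =>
    match e₁.toVal with
    | none => (FL v₂).push rec₁
    | some _ => ([], (FR e₁).fill e₂)

/-- The decomposition of an expression into an evaluation context and the expression in its
hole that has to be reduced next. -/
def Expr.decomp : Expr → Ectx × Expr
  | .val v => ([], .val v)
  | .var x => ([], .var x)
  | .fn f x e => ([], .fn f x e)
  | .app e₁ e₂ => decomp₂ .appR .appL e₁ e₂ e₁.decomp e₂.decomp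
  | .unop op e => decomp₁ (.unop op) e e.decomp
  | .binop op e₁ e₂ => decomp₂ (.binopR op) (.binopL op) e₁ e₂ e₁.decomp e₂.decomp
  | .ite e e₁ e₂ => decomp₁ (.ite e₁ e₂) e e.decomp
  | .pair e₁ e₂ => decomp₂ .pairR .pairL e₁ e₂ e₁.decomp e₂.decomp
  | .fst e => decomp₁ .fst e e.decomp
  | .snd e => decomp₁ .snd e e.decomp
  | .inl e => decomp₁ .inl e e.decomp
  | .inr e => decomp₁ .inr e e.decomp
  | .case e x e₁ y e₂ => decomp₁ (.case x e₁ y e₂) e e.decomp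
  | .alloc e => decomp₁ .alloc e e.decomp
  | .load e => decomp₁ .load e e.decomp
  | .store e₁ e₂ => decomp₂ .storeR .storeL e₁ e₂ e₁.decomp e₂.decomp
  | .allocTape e => decomp₁ .allocTape e e.decomp
  | .rand e => decomp₁ .rand e e.decomp
  | .randT e₁ e₂ => decomp₂ .randR .randL e₁ e₂ e₁.decomp e₂.decomp

def UnOp.eval : UnOp → Val → Option Val
  | .not, .lit (.bool b) => some (.lit (.bool !b))
  | .neg, .lit (.int z) => some (.lit (.int (-z)))
  | _, _ => none

def BinOp.eval : BinOp → Val → Val → Option Val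
  | .add, .lit (.int a), .lit (.int b) => some (.lit (.int (a + b)))
  | .sub, .lit (.int a), .lit (.int b) => some (.lit (.int (a - b)))
  | .mul, .lit (.int a), .lit (.int b) => some (.lit (.int (a * b)))
  | .and, .lit (.bool a), .lit (.bool b) => some (.lit (.bool (a && b)))
  | .or, .lit (.bool a), .lit (.bool b) => some (.lit (.bool (a || b)))
  | .eq, .lit a, .lit b => some (.lit (.bool (decide (a = b))))
  | .le, .lit (.int a), .lit (.int b) => some (.lit (.bool (decide (a ≤ b))))
  | .lt, .lit (.int a), .lit (.int b) => some (.lit (.bool (decide (a < b))))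
  | _, _, _ => none

/-- A presampling tape: a bound `N` and the presampled outcomes of `rand N`. -/
abbrev Tape := Σ N : ℕ, List (Fin (N + 1))

/-- Program states: a finite heap and finitely many presampling tapes. -/
structure State where
  heap : Finmap (fun _ : ℕ => Val)
  tapes : Finmap (fun _ : ℕ => Tape)

/-- A key outside a finite map. -/
def fresh {V : Type} (h : Finmap (fun _ : ℕ => V)) : ℕ := h.keys.sup id + 1

/-- Configurations. -/
abbrev Conf := Expr × State

/-- The integer value of a sample. -/
def Val.ofFin {n : ℕ} (k : Fin n) : Val := .lit (.int (k : ℕ))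

/-- A pure reduction result; `none` is a stuck term. -/
noncomputable def pureStep (σ : State) : Option Expr → SubDist Conf
  | some e => SubDist.ret (e, σ)
  | none => SubDist.zero

/-- `rand N`: sample uniformly from `{0, …, N}`. -/
noncomputable def randStep (N : ℕ) (σ : State) : SubDist Conf :=
  (SubDist.unif N).map fun k => (.val (.ofFin k), σ)

/-- `rand N ι`: pop the first element of the tape `ι` if its bound is `N` and it is not empty,
and sample uniformly from `{0, …, N}` otherwise; stuck if there is no tape `ι`. -/
noncomputable def randTapeStep (N ι : ℕ) (σ : State) : SubDist Conf :=
  match σ.tapes.lookup ι with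
  | none => SubDist.zero
  | some ⟨_, []⟩ => randStep N σ
  | some ⟨M, k :: ks⟩ =>
    if M = N then
      SubDist.ret (.val (.ofFin k), { σ with tapes := σ.tapes.insert ι ⟨M, ks⟩ })
    else randStep N σ

/-- The reduction of a redex; the zero sub-distribution on terms that are not redexes. -/
noncomputable def headStep (σ : State) : Expr → SubDist Conf
  | .fn f x e => SubDist.ret (.val (.recV f x e), σ)
  | .app (.val (.recV f x e)) (.val v) =>
      SubDist.ret (Expr.substB f (.recV f x e) (Expr.substB x v e), σ)
  | .unop op (.val v) => pureStep σ ((op.eval v).map .val)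
  | .binop op (.val v₁) (.val v₂) => pureStep σ ((op.eval v₁ v₂).map .val)
  | .ite (.val (.lit (.bool b))) e₁ e₂ => SubDist.ret (if b then e₁ else e₂, σ)
  | .pair (.val v₁) (.val v₂) => SubDist.ret (.val (.pairV v₁ v₂), σ)
  | .fst (.val (.pairV v₁ _)) => SubDist.ret (.val v₁, σ)
  | .snd (.val (.pairV _ v₂)) => SubDist.ret (.val v₂, σ)
  | .inl (.val v) => SubDist.ret (.val (.inlV v), σ)
  | .inr (.val v) => SubDist.ret (.val (.inrV v), σ)
  | .case (.val (.inlV v)) x e₁ _ _ => SubDist.ret (e₁.substB x v, σ)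
  | .case (.val (.inrV v)) _ _ y e₂ => SubDist.ret (e₂.substB y v, σ)
  | .alloc (.val v) =>
      SubDist.ret (.val (.lit (.loc (fresh σ.heap))),
        { σ with heap := σ.heap.insert (fresh σ.heap) v })
  | .load (.val (.lit (.loc l))) => pureStep σ ((σ.heap.lookup l).map .val)
  | .store (.val (.lit (.loc l))) (.val v) =>
      if l ∈ σ.heap then
        SubDist.ret (.val (.lit .unit), { σ with heap := σ.heap.insert l v })
      else SubDist.zero
  | .allocTape (.val (.lit (.int (.ofNat N)))) =>
      SubDist.ret (.val (.lit (.lbl (fresh σ.tapes))),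
        { σ with tapes := σ.tapes.insert (fresh σ.tapes) ⟨N, []⟩ })
  | .rand (.val (.lit (.int (.ofNat N)))) => randStep N σ
  | .randT (.val (.lit (.int (.ofNat N)))) (.val (.lit (.lbl ι))) => randTapeStep N ι σ
  | _ => SubDist.zero

/-- The small-step semantics: reduce the redex inside its evaluation context. -/
noncomputable def progStep (ρ : Conf) : SubDist Conf :=
  (headStep ρ.2 ρ.1.decomp.2).map fun ρ' => (Ectx.fill ρ.1.decomp.1 ρ'.1, ρ'.2)

/-- The Markov chain of program configurations; the final ones are those of a value. -/
noncomputable def prog : MarkovChain where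
  State := Conf
  step := progStep
  final ρ := ∃ v, ρ.1 = .val v
  final_step := by
    rintro ⟨_, σ⟩ ⟨v, rfl⟩ ρ'
    simp [progStep, Expr.decomp, headStep, SubDist.map, SubDist.bind, SubDist.zero]

/-- Append a uniform sample to the tape `ι`. -/
noncomputable def State.presample (σ : State) (ι : ℕ) : SubDist State :=
  match σ.tapes.lookup ι with
  | none => SubDist.zero
  | some ⟨N, ks⟩ =>
    (SubDist.unif N).map fun k => { σ with tapes := σ.tapes.insert ι ⟨N, ks ++ [k]⟩ }

/-- Monadic fold of `State.presample` over a list of tape labels. -/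
noncomputable def State.presamples : List ℕ → State → SubDist State
  | [], σ => SubDist.ret σ
  | ι :: l, σ => (σ.presample ι).bind (presamples l)

/-! ## Resource algebras -/

/-- A (discrete, unital) resource algebra. The extension order is divisibility `a ∣ b`. -/
class RA (M : Type) extends CommMonoid M where
  core : M → M
  valid : M → Prop
  core_mul : ∀ a : M, core a * a = a
  core_core : ∀ a : M, core (core a) = core a
  core_dvd : ∀ a b : M, a ∣ b → core a ∣ core b
  valid_one : valid 1
  valid_of_mul : ∀ a b : M, valid (a * b) → valid a

/-- The exclusive resource algebra, with a unit. -/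
inductive Excl (A : Type) where
  | unit
  | ex (a : A)
  | bot

namespace Excl

variable {A : Type}

protected def mul : Excl A → Excl A → Excl A
  | unit, y => y
  | x, unit => x
  | _, _ => bot

instance : CommMonoid (Excl A) where
  mul := Excl.mul
  one := unit
  mul_assoc a b c := by cases a <;> cases b <;> cases c <;> rfl
  mul_comm a b := by cases a <;> cases b <;> rfl
  one_mul a := by cases a <;> rfl
  mul_one a := by cases a <;> rfl

theorem one_def : (1 : Excl A) = unit := rfl

theorem bot_mul (x : Excl A) : bot * x = bot := by cases x <;> rfl

theorem ex_of_mul {x y : Excl A} {a : A} (hb : x * y ≠ bot) (h : x = ex a) : x * y = ex a := by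
  subst h
  cases y
  · rfl
  · exact absurd rfl hb
  · exact absurd rfl hb

instance : RA (Excl A) where
  core _ := 1
  valid a := a ≠ bot
  core_mul a := one_mul a
  core_core _ := rfl
  core_dvd _ _ _ := one_dvd _
  valid_one := nofun
  valid_of_mul a b h ha := h (by rw [ha, bot_mul])

end Excl

instance {K M : Type} [RA M] : RA (K → M) where
  core a k := RA.core (a k)
  valid a := ∀ k, RA.valid (a k)
  core_mul a := funext fun k => RA.core_mul (a k)
  core_core a := funext fun k => RA.core_core (a k)
  core_dvd a b h := by
    obtain ⟨c, rfl⟩ := h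
    choose d hd using fun k => RA.core_dvd (a k) (a k * c k) ⟨_, rfl⟩
    exact ⟨d, funext hd⟩
  valid_one _ := RA.valid_one
  valid_of_mul _ _ h k := RA.valid_of_mul _ _ (h k)

/-- The resource algebra of authoritative finite maps: `auth` is the (at most one)
authoritative view of the whole map, `frag` the exclusively owned entries. -/
@[ext] structure AuthMap (K V : Type) where
  auth : Excl (K → Option V)
  frag : K → Excl V

namespace AuthMap

variable {K V : Type}

instance : CommMonoid (AuthMap K V) where
  mul a b := ⟨a.auth * b.auth, a.frag * b.frag⟩
  one := ⟨1, 1⟩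
  mul_assoc a b c := AuthMap.ext (mul_assoc _ _ _) (mul_assoc _ _ _)
  mul_comm a b := AuthMap.ext (mul_comm _ _) (mul_comm _ _)
  one_mul a := AuthMap.ext (one_mul _) (one_mul _)
  mul_one a := AuthMap.ext (mul_one _) (mul_one _)

theorem auth_mul (a b : AuthMap K V) : (a * b).auth = a.auth * b.auth := rfl

theorem frag_mul (a b : AuthMap K V) (k : K) : (a * b).frag k = a.frag k * b.frag k := rfl

instance : RA (AuthMap K V) where
  core _ := 1
  valid a := a.auth ≠ .bot ∧ (∀ k, a.frag k ≠ .bot) ∧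
    ∀ s, a.auth = .ex s → ∀ k v, a.frag k = .ex v → s k = some v
  core_mul a := one_mul a
  core_core _ := rfl
  core_dvd _ _ _ := one_dvd _
  valid_one := ⟨nofun, fun _ => nofun, fun _ => nofun⟩
  valid_of_mul a b h := by
    obtain ⟨h1, h2, h3⟩ := h
    refine ⟨fun h => h1 ?_, fun k h => h2 k ?_, fun s hs k v hv => ?_⟩
    · rw [auth_mul, h, Excl.bot_mul]
    · rw [frag_mul, h, Excl.bot_mul]
    · exact h3 s (Excl.ex_of_mul h1 hs) k v (Excl.ex_of_mul (h2 k) hv)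

open Classical in
/-- Ownership of the single entry `k ↦ v`. -/
noncomputable def entry (k : K) (v : V) : AuthMap K V :=
  ⟨1, fun k' => if k' = k then .ex v else 1⟩

/-- The authoritative view of the map `s`. -/
def full (s : K → Option V) : AuthMap K V := ⟨.ex s, 1⟩

end AuthMap

instance {M₁ M₂ : Type} [RA M₁] [RA M₂] : RA (M₁ × M₂) where
  core a := (RA.core a.1, RA.core a.2)
  valid a := RA.valid a.1 ∧ RA.valid a.2
  core_mul a := Prod.ext (RA.core_mul _) (RA.core_mul _)
  core_core a := Prod.ext (RA.core_core _) (RA.core_core _)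
  core_dvd a b h := by
    obtain ⟨c, rfl⟩ := h
    obtain ⟨d, hd⟩ := RA.core_dvd a.1 (a.1 * c.1) ⟨_, rfl⟩
    obtain ⟨e, he⟩ := RA.core_dvd a.2 (a.2 * c.2) ⟨_, rfl⟩
    exact ⟨(d, e), Prod.ext hd he⟩
  valid_one := ⟨RA.valid_one, RA.valid_one⟩
  valid_of_mul _ _ h := ⟨RA.valid_of_mul _ _ h.1, RA.valid_of_mul _ _ h.2⟩

/-! ## Worlds

Propositions of the logic are predicates on a step index `n`, a world, and a resource. A world
at step index `n` is a finite map from invariant names to propositions that are known up to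
step index `n` only, which makes the definition well founded. -/

/-- Finite maps from invariant names. -/
def FinWorld (A : Type) : Type := { f : ℕ → Option A // {i | f i ≠ none}.Finite }

namespace FinWorld

variable {A B : Type}

/-- `w'` has all the entries of `w`. -/
def Ext (w w' : FinWorld A) : Prop := ∀ i p, w.1 i = some p → w'.1 i = some p

def map (g : A → B) (w : FinWorld A) : FinWorld B :=
  ⟨fun i => (w.1 i).map g, w.2.subset fun i hi h => hi (by simp [h])⟩

theorem Ext.map {g : A → B} {w w' : FinWorld A} (h : w.Ext w') :
    (w.map g).Ext (w'.map g) := by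
  intro i p hp
  obtain ⟨q, hq, rfl⟩ := Option.map_eq_some_iff.1 hp
  exact Option.map_eq_some_iff.2 ⟨q, h i q hq, rfl⟩

/-- The names of the invariants. -/
noncomputable def dom (w : FinWorld A) : Finset ℕ := w.2.toFinset

end FinWorld

section World

variable (M : Type) [RA M]

/-- A stage of the construction of propositions: the type of propositions up to step index `n`
(that is, with their truth at all indices below `n`), and the truth of `▷ p` at step index `n`
for such a proposition `p`. -/
structure Level where
  Approx : Type
  laterHolds : Approx → FinWorld Approx → M → Prop

variable {M} in
/-- The next stage adds the truth at step index `n`, which has to be monotone in the world and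
the resource, and to be closed under passing to smaller indices: `p` entails `▷ p`. -/
def Level.next (L : Level M) : Level M where
  Approx := { p : L.Approx × (FinWorld L.Approx → M → Prop) //
    (∀ w w' a b, w.Ext w' → a ∣ b → p.2 w a → p.2 w' b) ∧
    ∀ w a, p.2 w a → L.laterHolds p.1 w a }
  laterHolds p w a := p.1.2 (w.map fun q => q.1.1) a

def level : ℕ → Level M
  | 0 => ⟨PUnit, fun _ _ _ => True⟩
  | n + 1 => (level n).next

/-- Worlds at step index `n`. -/
abbrev World (n : ℕ) : Type := FinWorld (level M n).Approx

variable {M}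

/-- Restriction of a world to the next smaller step index. -/
def World.lower {n : ℕ} (w : World M (n + 1)) : World M n := w.map fun p => p.1.1

/-- `Future w w'`: the world `w'` can be reached from `w` by adding invariants and decreasing
the step index. -/
inductive Future : {n m : ℕ} → World M n → World M m → Prop
  | ext {n : ℕ} {w w' : World M n} : w.Ext w' → Future w w'
  | step {n m : ℕ} {w : World M (n + 1)} {w' : World M m} : Future w.lower w' → Future w w'

theorem Future.refl {n : ℕ} (w : World M n) : Future w w := .ext fun _ _ h => h

theorem Future.ext_trans {n k : ℕ} {w v : World M n} {u : World M k} (h : w.Ext v)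
    (hu : Future v u) : Future w u := by
  induction hu with
  | ext h' => exact .ext fun i p hp => h' i p (h i p hp)
  | step _ ih => exact .step (ih h.map)

theorem Future.trans {n m k : ℕ} {w : World M n} {v : World M m} {u : World M k}
    (h : Future w v) (hu : Future v u) : Future w u := by
  induction h with
  | ext h => exact hu.ext_trans h
  | step _ ih => exact .step (ih hu)

end World

/-! ## Propositions -/

/-- Propositions of the separation logic over the resource algebra `M`. -/
structure IProp (M : Type) [RA M] where
  holds : (n : ℕ) → World M n → M → Prop
  mono : ∀ {n m : ℕ} {w : World M n} {w' : World M m} {a b : M},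
    Future w w' → a ∣ b → holds n w a → holds m w' b

namespace IProp

variable {M : Type} [RA M]

/-- Entailment `P ⊢ Q`. -/
def Entails (P Q : IProp M) : Prop :=
  ∀ (n : ℕ) (w : World M n) (a : M), RA.valid a → P.holds n w a → Q.holds n w a

/-- Embedding of meta-level propositions. -/
def pure (φ : Prop) : IProp M := ⟨fun _ _ _ => φ, fun _ _ h => h⟩

def all {I : Sort*} (P : I → IProp M) : IProp M :=
  ⟨fun n w a => ∀ i, (P i).holds n w a, fun hw ha h i => (P i).mono hw ha (h i)⟩

def ex {I : Sort*} (P : I → IProp M) : IProp M :=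
  ⟨fun n w a => ∃ i, (P i).holds n w a, fun hw ha ⟨i, h⟩ => ⟨i, (P i).mono hw ha h⟩⟩

def or (P Q : IProp M) : IProp M :=
  ⟨fun n w a => P.holds n w a ∨ Q.holds n w a, fun hw ha h => h.imp (P.mono hw ha) (Q.mono hw ha)⟩

/-- Separating conjunction. -/
def sep (P Q : IProp M) : IProp M :=
  ⟨fun n w a => ∃ b c, a = b * c ∧ P.holds n w b ∧ Q.holds n w c, by
    rintro n m w w' a b hw ⟨d, rfl⟩ ⟨b, c, rfl, hP, hQ⟩
    exact ⟨b, c * d, mul_assoc _ _ _, P.mono hw dvd_rfl hP, Q.mono hw (dvd_mul_right _ _) hQ⟩⟩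

/-- Separating implication. -/
def wand (P Q : IProp M) : IProp M :=
  ⟨fun _ w a => ∀ (m : ℕ) (w' : World M m) (b : M), Future w w' → RA.valid (a * b) →
      P.holds m w' b → Q.holds m w' (a * b), by
    rintro n m w w' a b hw ⟨d, rfl⟩ h k u c hu hv hP
    refine Q.mono (Future.refl u) ?_ (h k u c (hw.trans hu) (RA.valid_of_mul _ d ?_) hP)
    · exact ⟨d, mul_right_comm _ _ _⟩
    · rwa [mul_right_comm]⟩

/-- Truth of `▷ P`. -/
def laterHolds (P : IProp M) : (n : ℕ) → World M n → M → Prop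
  | 0, _, _ => True
  | n + 1, w, a => P.holds n w.lower a

theorem laterHolds_of_holds (P : IProp M) {n : ℕ} {w : World M n} {a : M}
    (h : P.holds n w a) : P.laterHolds n w a := by
  cases n with
  | zero => trivial
  | succ n => exact P.mono (.step (Future.refl _)) dvd_rfl h

/-- The later modality `▷ P`. -/
def later (P : IProp M) : IProp M :=
  ⟨P.laterHolds, by
    intro n m w w' a b hw ha h
    induction hw with
    | @ext n w w' hw =>
      cases n with
      | zero => trivial
      | succ n => exact P.mono (.ext hw.map) ha h
    | step _ ih => exact ih (P.laterHolds_of_holds h)⟩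

/-- The persistence modality `□ P`. -/
def box (P : IProp M) : IProp M :=
  ⟨fun n w a => P.holds n w (RA.core a), fun hw ha h => P.mono hw (RA.core_dvd _ _ ha) h⟩

/-- Ownership of the resource `a`. -/
def own (a : M) : IProp M := ⟨fun _ _ b => a ∣ b, fun _ hb h => h.trans hb⟩

/-- The least fixed point of a monotone `F`, as the infimum of its pre-fixed points. -/
def lfp {X : Type} (F : (X → IProp M) → X → IProp M) (x : X) : IProp M :=
  ⟨fun n w a => ∀ Q : X → IProp M, (∀ y, (F Q y).Entails (Q y)) → (Q x).holds n w a,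
    fun hw ha h Q hQ => (Q x).mono hw ha (h Q hQ)⟩

/-! ### Invariants and fancy updates -/

/-- Resources with tokens for invariant names added: an enabled token for a name is needed to
open the invariant of that name, and a disabled token is needed to close it. -/
abbrev WithInv (M : Type) : Type := (ℕ → Excl Unit) × (ℕ → Excl Unit) × M

open Classical in
/-- The enabled tokens of the names in `E`. -/
noncomputable def enabled (E : Set ℕ) : WithInv M :=
  (fun i => if i ∈ E then .ex () else 1, 1, 1)

open Classical in
/-- The disabled tokens of the names in `D`. -/
noncomputable def disabled (D : Set ℕ) : WithInv M :=
  (1, fun i => if i ∈ D then .ex () else 1, 1)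

/-- World satisfaction, for the resource `t` owned outside of the invariants: the invariants
with names in `o` are open and have been replaced by their enabled tokens; the others hold
(later), each of a resource of its own. All disabled tokens but those of the open invariants
are kept here. -/
def WSat {n : ℕ} (w : World (WithInv M) n) (t : WithInv M) : Prop :=
  ∃ (o : Finset ℕ) (s : ℕ → WithInv M), o ⊆ w.dom ∧
    RA.valid (t * (enabled ↑o * disabled (↑o)ᶜ * ∏ i ∈ w.dom \ o, s i)) ∧
    ∀ i ∈ w.dom \ o, ∀ p, w.1 i = some p → (level (WithInv M) n).laterHolds p w (s i)

/-- The fancy update modality `|={E₁,E₂}=> P`: after a frame-preserving update of the resources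
and the addition of invariants, `P` holds, where the enabled tokens of `E₁` may be used, and
those of `E₂` have to be returned. There is no obligation at step index `0`; this is the
except-zero modality in the standard definition of the fancy update. -/
def fupd (E₁ E₂ : Set ℕ) (P : IProp (WithInv M)) : IProp (WithInv M) :=
  ⟨fun _ w a => ∀ (m : ℕ) (w' : World (WithInv M) m) (f : WithInv M), 0 < m → Future w w' →
      WSat w' (enabled E₁ * (a * f)) →
      ∃ (w'' : World (WithInv M) m) (b : WithInv M),
        w'.Ext w'' ∧ WSat w'' (enabled E₂ * (b * f)) ∧ P.holds m w'' b, by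
    rintro n m w w' a b hw ⟨d, rfl⟩ h k u f hk hu hs
    obtain ⟨u', c, hu', hs', hP⟩ := h k u (d * f) hk (hw.trans hu) (by rwa [← mul_assoc a])
    exact ⟨u', c * d, hu', by rwa [mul_assoc c], P.mono (Future.refl _) (dvd_mul_right _ _) hP⟩⟩

end IProp

infix:26 " ⊢ₛ " => IProp.Entails
infixr:35 " ∗ " => IProp.sep
infixr:30 " -∗ " => IProp.wand

/-! ## The refinement logic -/

open IProp

section Logic

/-- The resources for a model `C`: the heap, the presampling tapes, the state of the model, and
user-defined ghost state `G`. -/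
abbrev Res (G : Type) (C : MarkovChain) : Type :=
  WithInv (AuthMap ℕ Val × AuthMap ℕ Tape × AuthMap Unit C.State × G)

/-- Ownership of a part of the heap, the tapes, and the model state. -/
def ownState {G : Type} [RA G] {C : MarkovChain} (h : AuthMap ℕ Val) (t : AuthMap ℕ Tape)
    (m : AuthMap Unit C.State) : IProp (Res G C) :=
  own (1, 1, h, t, m, 1)

variable {G : Type} [RA G] {C : MarkovChain}

/-- `spec m`: the model is in state `m`. -/
noncomputable def spec (m : C.State) : IProp (Res G C) := ownState 1 1 (.entry () m)

/-- `pointsTo l v`: ownership of the location `l`, which contains `v`. -/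
noncomputable def pointsTo (l : ℕ) (v : Val) : IProp (Res G C) := ownState (.entry l v) 1 1

/-- `tape ι N ks`: ownership of the tape `ι`, which has the bound `N` and contents `ks`. -/
noncomputable def tape (ι N : ℕ) (ks : List (Fin (N + 1))) : IProp (Res G C) :=
  ownState 1 (.entry ι ⟨N, ks⟩) 1

/-- The model interpretation. -/
def modelInterp (m : C.State) : IProp (Res G C) := ownState 1 1 (.full fun _ => some m)

/-- The state interpretation. -/
def stateInterp (σ : State) : IProp (Res G C) :=
  ownState (.full fun l => σ.heap.lookup l) (.full fun ι => σ.tapes.lookup ι) 1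

/-- The functional of the coupling precondition. The four cases: a program step; a model step
coupled with a program step; a model step; a model step coupled with presampling steps. -/
def execCouplF (Z : C.State → Conf → IProp (Res G C))
    (Q : C.State × Conf → IProp (Res G C)) (s : C.State × Conf) : IProp (Res G C) :=
  (ex fun R : C.State → Conf → Prop =>
    pure (prog.Red s.2 ∧ (SubDist.ret s.1).Coupled (prog.step s.2) R) ∗
    all fun m : C.State => all fun ρ : Conf => all fun _ : R m ρ => fupd ∅ ∅ (Z m ρ)).or <|
  (ex fun R : C.State → Conf → Prop =>
    pure (prog.Red s.2 ∧ C.Red s.1 ∧ (C.step s.1).Coupled (prog.step s.2) R) ∗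
    all fun m : C.State => all fun ρ : Conf => all fun _ : R m ρ =>
      later (fupd ∅ ∅ (Z m ρ))).or <|
  (ex fun R : C.State → Conf → Prop =>
    pure (C.Red s.1 ∧ (C.step s.1).Coupled (SubDist.ret s.2) R) ∗
    all fun m : C.State => all fun _ : R m s.2 => later (fupd ∅ ∅ (Q (m, s.2)))).or <|
  ex fun R : C.State → State → Prop => ex fun l : List ℕ =>
    pure (C.Red s.1 ∧ (∀ ι ∈ l, ι ∈ s.2.2.tapes) ∧
      (C.step s.1).Coupled (State.presamples l s.2.2) R) ∗
    all fun m : C.State => all fun σ : State => all fun _ : R m σ =>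
      later (fupd ∅ ∅ (Q (m, (s.2.1, σ))))

/-- The coupling precondition. -/
def execCoupl (m : C.State) (ρ : Conf) (Z : C.State → Conf → IProp (Res G C)) :
    IProp (Res G C) :=
  lfp (execCouplF Z) (m, ρ)

/-- The functional of the refinement weakest precondition. -/
def rwpF (E : Set ℕ) (Φ : Val → IProp (Res G C)) (W : Expr → IProp (Res G C)) (e : Expr) :
    IProp (Res G C) :=
  match e.toVal with
  | some v => fupd E E (Φ v)
  | none => all fun σ : State => all fun m : C.State =>
      (modelInterp m ∗ stateInterp σ) -∗
      fupd E ∅ (execCoupl m (e, σ) fun m' ρ' =>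
        fupd ∅ E (modelInterp m' ∗ stateInterp ρ'.2 ∗ W ρ'.1))

/-- The refinement weakest precondition with mask `E`. -/
def rwp (E : Set ℕ) (e : Expr) (Φ : Val → IProp (Res G C)) : IProp (Res G C) :=
  lfp (rwpF E Φ) e

/-- The Hoare triple `{P} e {Φ}`. -/
def hoare (P : IProp (Res G C)) (e : Expr) (Φ : Val → IProp (Res G C)) : IProp (Res G C) :=
  box (P -∗ rwp Set.univ e Φ)

end Logic

/-! ## The Galton-Watson sampler -/

namespace Expr

/-- The expression `fun x => e`. -/
def lam (x : Binder) (e : Expr) : Expr := fn none x e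

/-- The expression `let x = e₁ in e₂`. -/
def letIn (x : ℕ) (e₁ e₂ : Expr) : Expr := app (lam (some x) e₂) e₁

/-- The expression `e₁; e₂`. -/
def seq (e₁ e₂ : Expr) : Expr := app (lam none e₂) e₁

/-- The unit value as an expression. -/
def tt : Expr := val (.lit .unit)

/-- `None`, and the empty list. -/
def none' : Expr := inl tt

/-- `Some e`. -/
def some' (e : Expr) : Expr := inr e

/-- The list with head `e₁` and tail `e₂`. -/
def cons (e₁ e₂ : Expr) : Expr := some' (pair e₁ e₂)

end Expr

/-! Variable names of the programs below. -/

abbrev xD : ℕ := 0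
abbrev xR : ℕ := 1
abbrev xS : ℕ := 2
abbrev xN : ℕ := 3
abbrev xF : ℕ := 4
abbrev xR' : ℕ := 5
abbrev xSampleNode : ℕ := 6
abbrev xRun : ℕ := 7
abbrev xV : ℕ := 8
abbrev xP : ℕ := 9
abbrev xI : ℕ := 10
abbrev xAux : ℕ := 11
abbrev xTl : ℕ := 12

open _root_.GWLogic.Expr

/-- `Stack.create () = ref []` -/
def stackCreate : Val := .recV none none (alloc none')

/-- `Stack.add v s = (s ← v :: !s)` -/
def stackAdd : Val :=
  .recV none (some xV) (lam (some xS) (store (var xS) (cons (var xV) (load (var xS)))))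

/-- `Stack.take s = match !s with [] => None | v :: t => s ← t; Some v` -/
def stackTake : Val :=
  .recV none (some xS)
    (.case (load (var xS))
      none none'
      (some xP) (seq (store (var xS) (snd (var xP))) (some' (fst (var xP)))))

/-- `List.init n f = [f 0, …, f (n - 1)]` -/
def listInit : Val :=
  .recV none (some xN) (lam (some xF)
    (app
      (fn (some xAux) (some xI)
        (ite (binop .eq (var xI) (var xN)) none'
          (letIn xV (app (var xF) (var xI))
            (letIn xTl (app (var xAux) (binop .add (var xI) (val (.lit (.int 1)))))
              (cons (var xV) (var xTl))))))
      (val (.lit (.int 0)))))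

/-- `rec sampleNode d r s () =`
`let n = d () in`
`let f = fun _ => (let r' = ref [] in Stack.add (sampleNode d r' s) s; r') in`
`r ← List.init n f` -/
def sampleNode : Val :=
  .recV (some xSampleNode) (some xD) (lam (some xR) (lam (some xS) (lam none
    (letIn xN (app (var xD) tt)
      (letIn xF
        (lam none
          (letIn xR' (alloc none')
            (seq
              (app (app (val stackAdd)
                (app (app (app (var xSampleNode) (var xD)) (var xR')) (var xS))) (var xS))
              (var xR'))))
        (store (var xR) (app (app (val listInit) (var xN)) (var xF))))))))

/-- `rec run s = match Stack.take s with Some f => f (); run s | None => ()` -/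
def run : Val :=
  .recV (some xRun) (some xS)
    (.case (app (val stackTake) (var xS))
      none tt
      (some xF) (seq (app (var xF) tt) (app (var xRun) (var xS))))

/-- `genTree d = let r = ref [] in let s = Stack.create () in`
`Stack.add (sampleNode d r s) s; run s; !r` -/
def genTree : Val :=
  .recV none (some xD)
    (letIn xR (alloc none')
      (letIn xS (app (val stackCreate) tt)
        (seq
          (app (app (val stackAdd)
            (app (app (app (val sampleNode) (var xD)) (var xR)) (var xS))) (var xS))
          (seq (app (val run) (var xS)) (load (var xR))))))

/-- The random walk on `ℕ` that goes from `n + 1` to `n + k` with probability `μ k`; it stops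
at `0`. -/
noncomputable def gwWalk (μ : SubDist ℕ) : MarkovChain where
  State := ℕ
  step
    | 0 => SubDist.zero
    | n + 1 => μ.map fun k => n + k
  final m := m = 0
  final_step := by rintro m rfl _; rfl

/-- The uniform distribution on `{0, …, N}`, as a distribution on `ℕ`. -/
noncomputable def unifNat (N : ℕ) : SubDist ℕ := (SubDist.unif N).map Fin.val

/-- The specification of the child-count sampler `d`: run with the single value `k` on the
tape `ι`, it consumes the tape and returns `k`. -/
noncomputable def samplerSpec (G : Type) [RA G] (C : MarkovChain) (N ι : ℕ) (d : Val) :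
    IProp (Res G C) :=
  all fun k : Fin (N + 1) =>
    hoare (tape ι N [k]) (app (val d) tt) fun v => pure (v = Val.ofFin k) ∗ tape ι N []

end GWLogic

open GWLogic

namespace GWLogic

/-! ## Expectations and couplings -/

-- The proof has two independent halves, a derivation in the logic and an adequacy theorem for the
-- logic.
--
-- The derivation rests on one invariant of `run`: at the head of the loop the tape is empty and the
-- number of tasks on the stack equals the state of the random walk. If the stack is not empty, the
-- walk's step from `n + 1` to `n + k` is coupled with presampling the same `k` onto the tape. The
-- popped task then calls `d`, which by its specification reads exactly this `k`, and pushes `k` new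
-- tasks onto the remaining `n`, so the invariant is restored. The recursion of `run` is justified
-- by the later modality that the model step provides: this is Löb induction, carried out as
-- induction on the step index in `symWP_run`. If the stack is empty, the walk is at `0` and the
-- program finishes by finitely many program steps without moving the model. The derivation uses
-- `rwp_bind`, `rwp_prog_step` and `rwp_presample_step`, packaged as symbolic execution in `SymWP`.
--
-- Adequacy (`execTerm_le_of_rwp`) says that a weakest precondition at step index `n + 1` bounds the
-- probability that the model stops within `n` steps by the termination probability of the program;
-- then one takes the supremum over `n`. The bound is proved by induction over the two least fixed
-- points. Couplings turn pointwise bounds into bounds of expectations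
-- (`SubDist.Coupled.expect_le`), the termination probability does not increase in expectation along
-- a program step, each model step uses up one later and one unit of `n`, and presampling leaves the
-- termination probability unchanged in expectation (`expect_presamples_execTerm`), because a sample
-- drawn early has the same law as one drawn when it is needed.

theorem tsum_iSup_of_monotone {A : Type} (f : ℕ → A → ℝ≥0∞) (hf : ∀ a, Monotone fun n => f n a) :
    ∑' a, ⨆ n, f n a = ⨆ n, ∑' a, f n a := by
  simp_rw [ENNReal.tsum_eq_iSup_sum]
  rw [iSup_comm]
  exact iSup_congr fun s => ENNReal.finsetSum_iSup_of_monotone fun a => hf a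

namespace SubDist

variable {A B D : Type}

/-- The expectation of `f`. -/
noncomputable def expect (μ : SubDist A) (f : A → ℝ≥0∞) : ℝ≥0∞ := ∑' a, μ.mass a * f a

theorem expect_ret (a : A) (f : A → ℝ≥0∞) : (ret a).expect f = f a := by
  classical
  simp only [expect, ret]
  rw [tsum_eq_single a fun b hb => by simp [hb]]
  simp

theorem expect_zero (f : A → ℝ≥0∞) : (zero : SubDist A).expect f = 0 := by
  simp [expect, zero]

theorem expect_bind (μ : SubDist A) (g : A → SubDist B) (f : B → ℝ≥0∞) :
    (μ.bind g).expect f = μ.expect fun a => (g a).expect f := by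
  simp only [expect, bind]
  simp_rw [← ENNReal.tsum_mul_right, ← ENNReal.tsum_mul_left]
  rw [ENNReal.tsum_comm]
  simp_rw [mul_assoc]

theorem expect_map (μ : SubDist A) (g : A → B) (f : B → ℝ≥0∞) :
    (μ.map g).expect f = μ.expect fun a => f (g a) := by
  simp only [map, expect_bind, expect_ret]

theorem expect_iSup (μ : SubDist A) (f : ℕ → A → ℝ≥0∞) (hf : ∀ a, Monotone fun n => f n a) :
    μ.expect (fun a => ⨆ n, f n a) = ⨆ n, μ.expect (f n) := by
  simp only [expect, ENNReal.mul_iSup]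
  exact tsum_iSup_of_monotone _ fun a m n h => mul_le_mul_right (hf a h) _

theorem expect_comm (μ : SubDist A) (ν : SubDist B) (f : A → B → ℝ≥0∞) :
    (μ.expect fun a => ν.expect (f a)) = ν.expect fun b => μ.expect fun a => f a b := by
  simp only [expect, ← ENNReal.tsum_mul_left]
  rw [ENNReal.tsum_comm]
  exact tsum_congr fun b => tsum_congr fun a => mul_left_comm _ _ _

theorem expect_unif_const (N : ℕ) (c : ℝ≥0∞) : (unif N).expect (fun _ => c) = c := by
  rw [expect, ENNReal.tsum_mul_right]
  simp only [unif, tsum_fintype, Finset.sum_const, Finset.card_univ, Fintype.card_fin, nsmul_eq_mul]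
  rw [ENNReal.mul_inv_cancel (by simp) (by simp), one_mul]

theorem mass_eq_expect (μ : SubDist A) [DecidableEq A] (a : A) :
    μ.mass a = μ.expect fun b => if b = a then 1 else 0 := by
  simp [expect]

theorem ext_expect {μ ν : SubDist A} (h : ∀ f, μ.expect f = ν.expect f) : μ = ν := by
  classical
  ext a
  rw [mass_eq_expect, mass_eq_expect, h]

theorem map_map (μ : SubDist A) (f : A → B) (g : B → D) :
    (μ.map f).map g = μ.map fun a => g (f a) :=
  ext_expect fun _ => by simp only [expect_map]

theorem map_ret (a : A) (f : A → B) : (ret a).map f = ret (f a) :=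
  ext_expect fun _ => by simp only [expect_map, expect_ret]

theorem map_zero (f : A → B) : (zero : SubDist A).map f = zero :=
  ext_expect fun _ => by simp only [expect_map, expect_zero]

theorem bind_ret (μ : SubDist A) : μ.bind ret = μ :=
  ext_expect fun _ => by simp only [expect_bind, expect_ret]

theorem ret_mass_self (a : A) : (ret a).mass a = 1 := by simp [ret]

theorem ret_mass_pos {a b : A} (h : 0 < (ret a).mass b) : b = a := by
  by_contra hb
  simp [ret, hb] at h

theorem map_mass_pos {μ : SubDist A} {f : A → B} {b : B} (h : 0 < (μ.map f).mass b) :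
    ∃ a, f a = b ∧ 0 < μ.mass a := by
  obtain ⟨a, ha⟩ : ∃ a, μ.mass a * (ret (f a)).mass b ≠ 0 := by
    by_contra! h'
    exact h.ne' (ENNReal.tsum_eq_zero.2 h')
  rw [mul_ne_zero_iff] at ha
  exact ⟨a, (ret_mass_pos (pos_iff_ne_zero.2 ha.2)).symm, pos_iff_ne_zero.2 ha.1⟩

theorem map_mass_pos_of {μ : SubDist A} (f : A → B) {a : A} (h : 0 < μ.mass a) :
    0 < (μ.map f).mass (f a) := by
  refine lt_of_lt_of_le ?_ (ENNReal.le_tsum a)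
  rwa [ret_mass_self, mul_one]

theorem map_mass_eq {μ : SubDist A} (f : A → B) (b : B) :
    (μ.map f).mass b = ∑' a, μ.mass a * (ret (f a)).mass b := rfl

theorem tsum_ret_mass (a : A) : ∑' b, (ret a).mass b = 1 := by
  have h := expect_ret a fun _ => 1
  simpa only [expect, mul_one] using h

/-! ### Couplings -/

/-- This is all that adequacy needs from a coupling. Exactness of the first marginal gives the
initial equality; an upper bound on the second marginal is enough at the end, which is why
left-partial couplings give lower bounds on termination. -/
theorem Coupled.expect_le {μ : SubDist A} {ν : SubDist B} {R : A → B → Prop}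
    (h : μ.Coupled ν R) {f : A → ℝ≥0∞} {g : B → ℝ≥0∞} (hR : ∀ a b, R a b → f a ≤ g b) :
    μ.expect f ≤ ν.expect g := by
  obtain ⟨ρ, h1, h2, h3⟩ := h
  calc μ.expect f = ∑' a, ∑' b, ρ.mass (a, b) * f a := by
        simp only [expect, ← h1, ENNReal.tsum_mul_right]
    _ ≤ ∑' a, ∑' b, ρ.mass (a, b) * g b := by
        refine ENNReal.tsum_le_tsum fun a => ENNReal.tsum_le_tsum fun b => ?_
        rcases eq_or_ne (ρ.mass (a, b)) 0 with h0 | h0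
        · simp [h0]
        · exact mul_le_mul_right (hR a b (h3 a b (pos_iff_ne_zero.2 h0))) _
    _ = ∑' b, (∑' a, ρ.mass (a, b)) * g b := by
        rw [ENNReal.tsum_comm]
        simp only [ENNReal.tsum_mul_right]
    _ ≤ ν.expect g := ENNReal.tsum_le_tsum fun b => mul_le_mul_left (h2 b) _

theorem Coupled.mono {μ : SubDist A} {ν : SubDist B} {R S : A → B → Prop}
    (h : μ.Coupled ν R) (hR : ∀ a b, R a b → S a b) : μ.Coupled ν S := by
  obtain ⟨ρ, h1, h2, h3⟩ := h
  exact ⟨ρ, h1, h2, fun a b h => hR a b (h3 a b h)⟩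

theorem Coupled.map {A' B' : Type} {μ : SubDist A} {ν : SubDist B} {R : A → B → Prop}
    (h : μ.Coupled ν R) (f : A → A') (g : B → B') :
    (μ.map f).Coupled (ν.map g) fun a b => ∃ a' b', a = f a' ∧ b = g b' ∧ R a' b' := by
  classical
  obtain ⟨ρ, h1, h2, h3⟩ := h
  -- The pushed-forward mass is written with a product of two Dirac masses, so that either
  -- coordinate can be summed out separately.
  have key : ∀ a b, (ρ.map fun p => (f p.1, g p.2)).mass (a, b) =
      ∑' a', ∑' b', ρ.mass (a', b') * ((ret (f a')).mass a * (ret (g b')).mass b) := by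
    intro a b
    rw [map_mass_eq, ENNReal.tsum_prod']
    refine tsum_congr fun a' => tsum_congr fun b' => ?_
    simp only [ret, Prod.mk.injEq]
    by_cases ha : a = f a' <;> by_cases hb : b = g b' <;> simp [ha, hb]
  refine ⟨ρ.map fun p => (f p.1, g p.2), fun a => ?_, fun b => ?_, fun a b hab => ?_⟩
  · simp only [key]
    rw [ENNReal.tsum_comm, map_mass_eq]
    refine tsum_congr fun a' => ?_
    rw [ENNReal.tsum_comm, ← h1, ← ENNReal.tsum_mul_right]
    refine tsum_congr fun b' => ?_
    simp_rw [ENNReal.tsum_mul_left, tsum_ret_mass, mul_one]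
  · simp only [key]
    rw [ENNReal.tsum_comm, map_mass_eq]
    have : ∀ a', ∑' a, ∑' b', ρ.mass (a', b') * ((ret (f a')).mass a * (ret (g b')).mass b)
        = ∑' b', ρ.mass (a', b') * (ret (g b')).mass b := by
      intro a'
      rw [ENNReal.tsum_comm]
      refine tsum_congr fun b' => ?_
      rw [ENNReal.tsum_mul_left, ENNReal.tsum_mul_right, tsum_ret_mass, one_mul]
    simp_rw [this]
    rw [ENNReal.tsum_comm]
    refine ENNReal.tsum_le_tsum fun b' => ?_
    rw [ENNReal.tsum_mul_right]
    exact mul_le_mul_left (h2 b') _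
  · obtain ⟨⟨a', b'⟩, hp, hpos⟩ := map_mass_pos hab
    simp only [Prod.mk.injEq] at hp
    exact ⟨a', b', hp.1.symm, hp.2.symm, h3 _ _ hpos⟩

/-- Since the second marginal is bounded by a Dirac mass at `b`, the coupling lives on pairs with
second coordinate `b`. That coordinate carries no information and may be relabelled. This serves
model steps taken without a program step. -/
theorem Coupled.ret_right {μ : SubDist A} {b : B} {R : A → B → Prop} (h : μ.Coupled (ret b) R)
    (c : D) : μ.Coupled (ret c) fun a _ => R a b := by
  have h' : μ.Coupled (ret b) fun a _ => R a b := by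
    obtain ⟨ρ, h1, h2, h3⟩ := h
    refine ⟨ρ, h1, h2, fun a b' hab => ?_⟩
    have hb : b' = b :=
      ret_mass_pos (hab.trans_le ((ENNReal.le_tsum (f := fun a => ρ.mass (a, b')) a).trans (h2 b')))
    exact hb ▸ h3 a b' hab
  have := h'.map id fun _ => c
  rw [map_ret, show μ.map id = μ from μ.bind_ret] at this
  exact this.mono fun a _ ⟨a', b', ha, _, hR⟩ => ha ▸ hR

theorem coupled_diag (μ : SubDist A) : μ.Coupled μ Eq := by
  classical
  have key : ∀ a b, (μ.map fun a => (a, a)).mass (a, b) = if a = b then μ.mass a else 0 := by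
    intro a b
    rw [map_mass_eq, tsum_eq_single a]
    · by_cases h : a = b <;> simp [ret, h, eq_comm]
    · intro c hc
      simp [ret, hc.symm]
  refine ⟨μ.map fun a => (a, a), fun a => ?_, fun b => ?_, fun a b h => ?_⟩
  · simp [key]
  · simp [key]
  · by_contra hab
    simp [key, hab] at h

theorem coupled_map_map (μ : SubDist D) (f : D → A) (g : D → B) :
    (μ.map f).Coupled (μ.map g) fun a b => ∃ x, a = f x ∧ b = g x :=
  (μ.coupled_diag.map f g).mono fun _ _ ⟨x, _, ha, hb, h⟩ => ⟨x, ha, h ▸ hb⟩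

theorem coupled_ret (a : A) (b : B) : (ret a).Coupled (ret b) fun a' b' => a' = a ∧ b' = b := by
  have h := coupled_map_map (ret ()) (fun _ => a) fun _ => b
  rw [map_ret, map_ret] at h
  exact h.mono fun _ _ ⟨_, h⟩ => h

end SubDist

/-! ## Termination probabilities -/

namespace MarkovChain

variable (C : MarkovChain)

/-- The probability of reaching a final state in at most `n` steps. -/
noncomputable def termN (n : ℕ) (m : C.State) : ℝ≥0∞ := ∑' m', (C.execN n m).mass m'

theorem termN_eq_expect (n : ℕ) (m : C.State) :
    C.termN n m = (C.execN n m).expect fun _ => 1 := by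
  simp [termN, SubDist.expect]

theorem termN_le_one (n : ℕ) (m : C.State) : C.termN n m ≤ 1 := (C.execN n m).le_one

theorem termN_of_final {m : C.State} (h : C.final m) (n : ℕ) : C.termN n m = 1 := by
  cases n <;> simp [termN_eq_expect, execN, h, SubDist.expect_ret]

theorem termN_zero {m : C.State} (h : ¬ C.final m) : C.termN 0 m = 0 := by
  simp [termN_eq_expect, execN, h, SubDist.expect_zero]

theorem termN_succ {m : C.State} (h : ¬ C.final m) (n : ℕ) :
    C.termN (n + 1) m = (C.step m).expect (C.termN n) := by
  simp only [funext (C.termN_eq_expect _), execN, h, if_false, SubDist.expect_bind]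

theorem Red.not_final {m : C.State} (h : C.Red m) : ¬ C.final m := fun hf => by
  obtain ⟨m', hm⟩ := h
  exact hm.ne' (C.final_step m hf m')

theorem step_final {m : C.State} (h : C.final m) (f : C.State → ℝ≥0∞) :
    (C.step m).expect f = 0 := by
  simp [SubDist.expect, C.final_step m h]

theorem execN_mass_mono (m m' : C.State) : Monotone fun n => (C.execN n m).mass m' := by
  refine monotone_nat_of_le_succ fun n => ?_
  induction n generalizing m with
  | zero =>
    by_cases h : C.final m
    · simp [execN, h]
    · simp [execN, h, SubDist.zero]
  | succ n ih =>
    by_cases h : C.final m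
    · simp [execN, h]
    · simp only [execN, h, if_false]
      exact ENNReal.tsum_le_tsum fun a => mul_le_mul_right (ih a) _

theorem termN_mono (m : C.State) : Monotone fun n => C.termN n m :=
  fun _ _ h => ENNReal.tsum_le_tsum fun m' => C.execN_mass_mono m m' h

theorem execTerm_eq_iSup (m : C.State) : C.execTerm m = ⨆ n, C.termN n m :=
  tsum_iSup_of_monotone _ fun m' => C.execN_mass_mono m m'

theorem termN_le_execTerm (n : ℕ) (m : C.State) : C.termN n m ≤ C.execTerm m := by
  rw [execTerm_eq_iSup]
  exact le_iSup (fun n => C.termN n m) n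

theorem execTerm_of_final {m : C.State} (h : C.final m) : C.execTerm m = 1 := by
  simp [execTerm_eq_iSup, C.termN_of_final h]

theorem expect_execTerm (μ : SubDist C.State) :
    μ.expect C.execTerm = ⨆ n, μ.expect (C.termN n) := by
  rw [← μ.expect_iSup _ C.termN_mono]
  simp only [← execTerm_eq_iSup]

/-- Away from final states this comes from exchanging the expectation with the supremum over step
counts; final states have no outgoing mass. -/
theorem expect_step_le_execTerm (m : C.State) : (C.step m).expect C.execTerm ≤ C.execTerm m := by
  by_cases h : C.final m
  · simp [C.step_final h]
  · rw [expect_execTerm]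
    exact iSup_le fun n => (C.termN_succ h n).ge.trans (C.termN_le_execTerm _ _)

end MarkovChain

/-! ## Evaluation contexts -/

theorem Expr.eq_of_toVal {e : Expr} {v : Val} (h : e.toVal = some v) : e = .val v := by
  cases e <;> simp_all [Expr.toVal]

theorem Frame.toVal_fill (F : Frame) (e : Expr) : (F.fill e).toVal = none := by
  cases F <;> rfl

theorem Ectx.toVal_fill (K : Ectx) {e : Expr} (h : e.toVal = none) : (K.fill e).toVal = none := by
  cases K with
  | nil => exact h
  | cons F K => exact F.toVal_fill _

theorem Frame.decomp_fill (F : Frame) {e : Expr} (h : e.toVal = none) :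
    (F.fill e).decomp = F.push e.decomp := by
  cases F <;> simp only [Frame.fill, Expr.decomp, decomp₁, decomp₂, h] <;> rfl

theorem Ectx.decomp_fill (K : Ectx) {e : Expr} (h : e.toVal = none) :
    (K.fill e).decomp = (K ++ e.decomp.1, e.decomp.2) := by
  induction K with
  | nil => rfl
  | cons F K ih =>
    change (F.fill (Ectx.fill K e)).decomp = _
    rw [F.decomp_fill (Ectx.toVal_fill K h), ih]
    rfl

theorem Ectx.fill_append (K K' : Ectx) (e : Expr) : Ectx.fill (K ++ K') e = K.fill (K'.fill e) :=
  List.foldr_append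

/-- Decomposition passes through `K` as long as the hole is not a value, so both sides reduce the
same redex. The bind rule depends on this. -/
theorem progStep_fill (K : Ectx) {e : Expr} (h : e.toVal = none) (σ : State) :
    progStep (K.fill e, σ) = (progStep (e, σ)).map fun ρ => (K.fill ρ.1, ρ.2) := by
  simp only [progStep, K.decomp_fill h, SubDist.map_map, Ectx.fill_append]

theorem prog_final {e : Expr} {σ : State} : prog.final (e, σ) ↔ e.toVal ≠ none := by
  constructor
  · rintro ⟨v, rfl : e = _⟩
    exact nofun
  · intro h
    obtain ⟨v, hv⟩ := Option.ne_none_iff_exists'.1 h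
    exact ⟨v, Expr.eq_of_toVal hv⟩

/-! ## Presampling does not change the termination probability -/

/-- The state with its tapes replaced by `t`. -/
def State.withTapes (σ : State) (t : Finmap fun _ : ℕ => Tape) : State := ⟨σ.heap, t⟩

/-- The reduction of the redex `e` neither reads nor writes the tapes. -/
def Expr.TapeFree (e : Expr) : Prop :=
  ∀ (σ : State) (t : Finmap fun _ : ℕ => Tape),
    headStep (σ.withTapes t) e = (headStep σ e).map fun p => (p.1, p.2.withTapes t)

/-- Isolates the only two redexes that interact with tapes, so that presampling has to be examined
for these alone. -/
theorem headStep_tapeFree (e : Expr) :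
    e.TapeFree ∨ (∃ N : ℕ, e = .allocTape (.val (.lit (.int (.ofNat N))))) ∨
      ∃ N ι : ℕ, e = .randT (.val (.lit (.int (.ofNat N)))) (.val (.lit (.lbl ι))) := by
  by_cases h1 : ∃ N : ℕ, e = .allocTape (.val (.lit (.int (.ofNat N))))
  · exact .inr (.inl h1)
  by_cases h2 : ∃ N ι : ℕ, e = .randT (.val (.lit (.int (.ofNat N)))) (.val (.lit (.lbl ι)))
  · exact .inr (.inr h2)
  refine .inl fun σ t => ?_
  unfold headStep
  split <;> simp only [SubDist.map_ret, SubDist.map_zero, State.withTapes]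
  · rename_i op v
    cases op.eval v <;> simp [pureStep, SubDist.map_ret, SubDist.map_zero]
  · rename_i op v₁ v₂
    cases op.eval v₁ v₂ <;> simp [pureStep, SubDist.map_ret, SubDist.map_zero]
  · rename_i l
    cases σ.heap.lookup l <;> simp [pureStep, SubDist.map_ret, SubDist.map_zero]
  · split <;> simp_all [SubDist.map_ret, SubDist.map_zero]
  · exact absurd ⟨_, rfl⟩ h1
  · simp only [randStep, SubDist.map_map]
  · exact absurd ⟨_, _, rfl⟩ h2

/-- Write the tape `ι`. -/
def State.setTape (σ : State) (ι : ℕ) (t : Tape) : State := σ.withTapes (σ.tapes.insert ι t)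

theorem State.lookup_setTape (σ : State) (ι : ℕ) (t : Tape) :
    (σ.setTape ι t).tapes.lookup ι = some t :=
  Finmap.lookup_insert _

theorem State.setTape_setTape (σ : State) (ι : ℕ) (t u : Tape) :
    (σ.setTape ι t).setTape ι u = σ.setTape ι u := by
  simp [State.setTape, State.withTapes, Finmap.insert_insert]

theorem State.setTape_self {σ : State} {ι : ℕ} {t : Tape} (h : σ.tapes.lookup ι = some t) :
    σ.setTape ι t = σ := by
  cases σ with
  | mk hp tp =>
    simp only [State.setTape, State.withTapes, State.mk.injEq, true_and]
    refine Finmap.ext_lookup fun i => ?_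
    rcases eq_or_ne i ι with rfl | hi
    · rw [Finmap.lookup_insert, h]
    · rw [Finmap.lookup_insert_of_ne _ hi]

theorem State.presample_of_lookup {σ : State} {ι N : ℕ} {ks : List (Fin (N + 1))}
    (h : σ.tapes.lookup ι = some ⟨N, ks⟩) :
    σ.presample ι = (SubDist.unif N).map fun k => σ.setTape ι ⟨N, ks ++ [k]⟩ := by
  simp only [presample, h]
  rfl

theorem fresh_notMem {V : Type} (h : Finmap fun _ : ℕ => V) : fresh h ∉ h := by
  intro hm
  have := Finset.le_sup (f := id) (Finmap.mem_keys.2 hm)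
  simp only [id, fresh] at this
  omega

theorem fresh_insert_of_mem {V : Type} {h : Finmap fun _ : ℕ => V} {i : ℕ} (hi : i ∈ h) (v : V) :
    fresh (h.insert i v) = fresh h := by
  have : (h.insert i v).keys = h.keys := by
    ext j
    simp only [Finmap.mem_keys, Finmap.mem_insert]
    exact ⟨fun h => h.elim (fun h => h ▸ hi) id, .inr⟩
  simp [fresh, this]

/-- `F` is invariant under presampling onto the tape `ι`. -/
def PresampleInvariant (ι : ℕ) (F : Conf → ℝ≥0∞) : Prop :=
  ∀ (e : Expr) (σ : State) (N : ℕ) (ks : List (Fin (N + 1))),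
    σ.tapes.lookup ι = some ⟨N, ks⟩ →
    F (e, σ) = (SubDist.unif N).expect fun k => F (e, σ.setTape ι ⟨N, ks ++ [k]⟩)

theorem PresampleInvariant.randStep {ι : ℕ} {F : Conf → ℝ≥0∞} (hF : PresampleInvariant ι F)
    {σ : State} {N : ℕ} {ks : List (Fin (N + 1))} (h : σ.tapes.lookup ι = some ⟨N, ks⟩) (M : ℕ) :
    (randStep M σ).expect F =
      (SubDist.unif N).expect fun k => (randStep M (σ.setTape ι ⟨N, ks ++ [k]⟩)).expect F := by
  simp only [GWLogic.randStep, SubDist.expect_map]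
  rw [SubDist.expect_comm]
  congr 1
  funext j
  exact hF _ _ _ _ h

/-- The sample appended early and the one step of reduction can be exchanged. For most redexes this
is Fubini. The exception is a read from `ι` itself when it is empty: the presampled value is then
popped at once, which is the same as sampling now. A read with a different bound ignores the tape
contents. -/
theorem PresampleInvariant.headStep {ι : ℕ} {F : Conf → ℝ≥0∞} (hF : PresampleInvariant ι F)
    {σ : State} {N : ℕ} {ks : List (Fin (N + 1))} (h : σ.tapes.lookup ι = some ⟨N, ks⟩)
    (e : Expr) :
    (headStep σ e).expect F =
      (SubDist.unif N).expect fun k => (headStep (σ.setTape ι ⟨N, ks ++ [k]⟩) e).expect F := by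
  have hι : ι ∈ σ.tapes := Finmap.mem_iff.2 ⟨_, h⟩
  obtain he | ⟨M, rfl⟩ | ⟨M, κ, rfl⟩ := headStep_tapeFree e
  -- Taking `t` to be the present tapes writes the unmodified step as a push-forward of the same
  -- distribution as the modified one, so that the two sides differ only in the tapes put back
  -- afterwards.
  · have hσ := he σ σ.tapes
    rw [show σ.withTapes σ.tapes = σ from rfl] at hσ
    simp only [State.setTape, he σ]
    rw [hσ]
    simp only [SubDist.expect_map]
    rw [SubDist.expect_comm]
    congr 1
    funext p
    exact hF p.1 (p.2.withTapes σ.tapes) N ks h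
  · simp only [GWLogic.headStep, SubDist.expect_ret]
    -- As `ι` is already allocated, appending to it does not change the label chosen for the new
    -- tape, and the two insertions commute.
    have hne : ι ≠ fresh σ.tapes := fun h' => fresh_notMem σ.tapes (h' ▸ hι)
    rw [hF _ _ N ks (by rw [Finmap.lookup_insert_of_ne _ hne]; exact h)]
    simp only [State.setTape, State.withTapes, fresh_insert_of_mem hι]
    simp only [Finmap.insert_insert_of_ne _ hne]
  · simp only [GWLogic.headStep]
    rcases eq_or_ne κ ι with rfl | hκ
    · cases ks with
      | nil =>
        simp only [randTapeStep, h, State.lookup_setTape, List.nil_append]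
        by_cases hNM : N = M
        · subst hNM
          simp only [if_true, SubDist.expect_ret, GWLogic.randStep, SubDist.expect_map]
          congr 1
          funext k
          congr 2
          -- Popping the presampled value leaves the tape empty again, that is, the original state.
          exact (State.setTape_self h).symm.trans (State.setTape_setTape σ κ _ _).symm
        · simp only [hNM, if_false]
          exact hF.randStep h M
      | cons j js =>
        simp only [randTapeStep, h, State.lookup_setTape, List.cons_append]
        by_cases hNM : N = M
        · subst hNM
          simp only [if_true, SubDist.expect_ret]
          -- The pop removes the old head `j`; the new sample stays at the end of `js`, where
          -- invariance of `F` applies.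
          rw [hF _ _ N js (Finmap.lookup_insert _)]
          congr 1
          funext k
          congr 2
          exact (State.setTape_setTape σ κ _ _).trans (State.setTape_setTape σ κ _ _).symm
        · simp only [hNM, if_false]
          exact hF.randStep h M
    · have hl : ∀ k, (σ.setTape ι ⟨N, ks ++ [k]⟩).tapes.lookup κ = σ.tapes.lookup κ :=
        fun k => Finmap.lookup_insert_of_ne _ hκ
      simp only [randTapeStep, hl]
      rcases hκl : σ.tapes.lookup κ with _ | ⟨L, _ | ⟨j, js⟩⟩
      · simp only [SubDist.expect_zero, SubDist.expect_unif_const]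
      · exact hF.randStep h M
      · by_cases hLM : L = M
        · subst hLM
          simp only [if_true, SubDist.expect_ret]
          rw [hF _ _ N ks (by rw [Finmap.lookup_insert_of_ne _ hκ.symm]; exact h)]
          simp only [State.setTape, State.withTapes, Finmap.insert_insert_of_ne _ hκ]
        · simp only [hLM, if_false]
          exact hF.randStep h M

/-- Presampling is not a program step, so the equality holds for each number of steps exactly, and
induction on that number is possible. At zero steps only whether the expression is a value matters.
-/
theorem presampleInvariant_termN (ι n : ℕ) : PresampleInvariant ι (prog.termN n) := by
  induction n with
  | zero =>
    intro e σ N ks h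
    by_cases he : e.toVal = none
    · have hf : ∀ σ, ¬ prog.final (e, σ) := fun σ => by rw [prog_final]; exact not_not.2 he
      simp [prog.termN_zero (hf _), SubDist.expect]
    · have hf : ∀ σ, prog.final (e, σ) := fun σ => prog_final.2 he
      simp only [prog.termN_of_final (hf _), SubDist.expect_unif_const]
  | succ n ih =>
    intro e σ N ks h
    by_cases he : e.toVal = none
    · have hf : ∀ σ, ¬ prog.final (e, σ) := fun σ => by rw [prog_final]; exact not_not.2 he
      simp only [prog.termN_succ (hf _)]
      have hs : ∀ σ, (prog.step (e, σ)).expect (prog.termN n) = (headStep σ e.decomp.2).expect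
          fun ρ => prog.termN n (e.decomp.1.fill ρ.1, ρ.2) := fun σ => SubDist.expect_map _ _ _
      simp only [hs]
      exact PresampleInvariant.headStep
        (F := fun ρ => prog.termN n (e.decomp.1.fill ρ.1, ρ.2))
        (fun e' σ' N ks h => ih _ _ N ks h) h _
    · have hf : ∀ σ, prog.final (e, σ) := fun σ => prog_final.2 he
      simp only [prog.termN_of_final (hf _), SubDist.expect_unif_const]

theorem expect_presample_termN {ι : ℕ} {σ : State} (h : ι ∈ σ.tapes) (e : Expr) (n : ℕ) :
    (σ.presample ι).expect (fun σ' => prog.termN n (e, σ')) = prog.termN n (e, σ) := by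
  obtain ⟨⟨N, ks⟩, ht⟩ := Finmap.mem_iff.1 h
  rw [State.presample_of_lookup ht, SubDist.expect_map, presampleInvariant_termN ι n e σ N ks ht]

theorem State.mem_tapes_setTape {σ : State} {ι κ : ℕ} {t : Tape} (h : κ ∈ σ.tapes) :
    κ ∈ (σ.setTape ι t).tapes :=
  Finmap.mem_insert.2 (.inr h)

theorem expect_presamples_termN (e : Expr) (n : ℕ) (l : List ℕ) {σ : State}
    (h : ∀ ι ∈ l, ι ∈ σ.tapes) :
    (State.presamples l σ).expect (fun σ' => prog.termN n (e, σ')) = prog.termN n (e, σ) := by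
  induction l generalizing σ with
  | nil => exact SubDist.expect_ret _ _
  | cons ι l ih =>
    simp only [State.presamples, SubDist.expect_bind]
    rw [← expect_presample_termN (h ι List.mem_cons_self)]
    obtain ⟨⟨N, ks⟩, ht⟩ := Finmap.mem_iff.1 (h ι List.mem_cons_self)
    simp only [State.presample_of_lookup ht, SubDist.expect_map]
    congr 1
    funext k
    exact ih fun κ hκ => State.mem_tapes_setTape (h κ (List.mem_cons_of_mem _ hκ))

theorem expect_presamples_execTerm (e : Expr) {l : List ℕ} {σ : State}
    (h : ∀ ι ∈ l, ι ∈ σ.tapes) :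
    (State.presamples l σ).expect (fun σ' => prog.execTerm (e, σ')) = prog.execTerm (e, σ) := by
  have ht : ∀ σ' : State, prog.execTerm (e, σ') = ⨆ n, prog.termN n (e, σ') :=
    fun σ' => prog.execTerm_eq_iSup (e, σ')
  refine (congrArg _ (funext ht)).trans (Eq.trans ?_ (ht σ).symm)
  refine (SubDist.expect_iSup _ _ fun σ' => prog.termN_mono (e, σ')).trans ?_
  exact iSup_congr fun n => expect_presamples_termN e n l h

open IProp

/-! ## Basic rules of the logic -/

theorem RA.valid_of_dvd {M : Type} [RA M] {a b : M} (h : a ∣ b) (hb : RA.valid b) :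
    RA.valid a := by
  obtain ⟨c, rfl⟩ := h
  exact RA.valid_of_mul a c hb

theorem RA.valid_mul_right {M : Type} [RA M] {a b : M} (h : RA.valid (a * b)) : RA.valid b :=
  RA.valid_of_dvd (dvd_mul_left b a) h

theorem RA.core_mul_core {M : Type} [RA M] (a : M) : RA.core a * RA.core a = RA.core a := by
  simpa only [RA.core_core] using RA.core_mul (RA.core a)

theorem RA.core_one {M : Type} [RA M] : RA.core (1 : M) = 1 := by
  simpa only [mul_one] using RA.core_mul (1 : M)

namespace IProp

section

variable {M : Type} [RA M]

theorem holds_future (P : IProp M) {n m : ℕ} {w : World M n} {w' : World M m} {a : M}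
    (hw : Future w w') (h : P.holds n w a) : P.holds m w' a :=
  P.mono hw dvd_rfl h

theorem holds_dvd (P : IProp M) {n : ℕ} {w : World M n} {a b : M}
    (ha : a ∣ b) (h : P.holds n w a) : P.holds n w b :=
  P.mono (Future.refl w) ha h

theorem pure_sep_holds {φ : Prop} {P : IProp M} {n : ℕ} {w : World M n} {a : M} :
    (pure φ ∗ P).holds n w a ↔ φ ∧ P.holds n w a := by
  constructor
  · rintro ⟨b, c, rfl, hφ, hP⟩
    exact ⟨hφ, P.holds_dvd (dvd_mul_left c b) hP⟩
  · exact fun ⟨hφ, hP⟩ => ⟨1, a, (one_mul a).symm, hφ, hP⟩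

theorem sep_mono {P P' Q Q' : IProp M} (hP : P ⊢ₛ P') (hQ : Q ⊢ₛ Q') : (P ∗ Q) ⊢ₛ (P' ∗ Q') := by
  rintro n w _ ha ⟨b, c, rfl, h1, h2⟩
  exact ⟨b, c, rfl, hP n w b (RA.valid_of_mul _ _ ha) h1, hQ n w c (RA.valid_mul_right ha) h2⟩

/-- The implication is needed only in strict futures: at index zero there is nothing to prove. The
two sides may use different resources, which allows a frame to be added under a later. -/
theorem laterHolds_map {P Q : IProp M} {n : ℕ} {w : World M n} {a b : M}
    (h : P.laterHolds n w a)
    (hPQ : ∀ {m : ℕ} {w' : World M m}, Future w w' → P.holds m w' a → Q.holds m w' b) :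
    Q.laterHolds n w b := by
  cases n with
  | zero => trivial
  | succ n => exact hPQ (.step (Future.refl _)) h

theorem later_mono {P Q : IProp M} (h : P ⊢ₛ Q) : later P ⊢ₛ later Q := fun _ _ _ ha hP =>
  laterHolds_map hP fun _ hP' => h _ _ _ ha hP'

/-- `lfp F` is a pre-fixed point of a monotone `F`. -/
theorem lfp_fold {X : Type} {F : (X → IProp M) → X → IProp M}
    (hF : ∀ P Q : X → IProp M, (∀ x, P x ⊢ₛ Q x) → ∀ x, F P x ⊢ₛ F Q x) (x : X) :
    F (lfp F) x ⊢ₛ lfp F x := fun n w a ha h Q hQ =>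
  hQ x n w a ha (hF (lfp F) Q (fun _ _ _ _ _ h' => h' Q hQ) x n w a ha h)

/-- `lfp F` is a post-fixed point of a monotone `F`. -/
theorem lfp_unfold {X : Type} {F : (X → IProp M) → X → IProp M}
    (hF : ∀ P Q : X → IProp M, (∀ x, P x ⊢ₛ Q x) → ∀ x, F P x ⊢ₛ F Q x) (x : X) :
    lfp F x ⊢ₛ F (lfp F) x := fun _ _ _ _ h =>
  h (F (lfp F)) fun y => hF _ _ (lfp_fold hF) y

theorem lfp_induct {X : Type} {F : (X → IProp M) → X → IProp M} {Q : X → IProp M}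
    (h : ∀ x, F Q x ⊢ₛ Q x) (x : X) : lfp F x ⊢ₛ Q x := fun _ _ _ _ hx => hx Q h

end

-- World satisfaction and fancy updates

section

variable {M : Type} [RA M]

theorem enabled_empty : enabled (M := M) ∅ = 1 := by
  simp [enabled]
  rfl

theorem WSat.update {n : ℕ} {w : World (WithInv M) n} {t t' : WithInv M} (h : WSat w t)
    (ht : ∀ f, RA.valid (t * f) → RA.valid (t' * f)) : WSat w t' := by
  obtain ⟨o, s, ho, hv, hs⟩ := h
  exact ⟨o, s, ho, ht _ hv, hs⟩

theorem WSat.valid {n : ℕ} {w : World (WithInv M) n} {t : WithInv M} (h : WSat w t) :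
    RA.valid t := by
  obtain ⟨o, s, -, hv, -⟩ := h
  exact RA.valid_of_mul _ _ hv

theorem dom_map {A B : Type} (g : A → B) (w : FinWorld A) : (w.map g).dom = w.dom := by
  ext i
  simp [FinWorld.dom, FinWorld.map]

/-- Each invariant at index `n + 1` carries in its type the proof that it entails its own later.
This is exactly what is needed to keep the same resources when the index drops. -/
theorem WSat.lower {n : ℕ} {w : World (WithInv M) (n + 1)} {t : WithInv M} (h : WSat w t) :
    WSat w.lower t := by
  obtain ⟨o, s, ho, hv, hs⟩ := h
  have hd : w.lower.dom = w.dom := dom_map _ _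
  refine ⟨o, s, by rwa [hd], by rwa [hd], fun i hi p hp => ?_⟩
  rw [hd] at hi
  obtain ⟨q, hq, rfl⟩ := Option.map_eq_some_iff.1 hp
  exact q.2.2 w.lower (s i) (hs i hi q hq)

/-- Use a fancy update, in a world in which the invariants hold. -/
theorem fupd_elim {E₁ E₂ : Set ℕ} {P : IProp (WithInv M)} {n : ℕ} {w : World (WithInv M) n}
    {a f : WithInv M} (h : (fupd E₁ E₂ P).holds n w a) (hn : 0 < n)
    (hw : WSat w (enabled E₁ * (a * f))) :
    ∃ (w' : World (WithInv M) n) (b : WithInv M),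
      Future w w' ∧ WSat w' (enabled E₂ * (b * f)) ∧ P.holds n w' b := by
  obtain ⟨w', b, h1, h2, h3⟩ := h n w f hn (Future.refl w) hw
  exact ⟨w', b, .ext h1, h2, h3⟩

theorem fupd_intro {E : Set ℕ} {P : IProp (WithInv M)} {n : ℕ} {w : World (WithInv M) n}
    {a : WithInv M} (h : P.holds n w a) : (fupd E E P).holds n w a := fun _ w' _ _ hw hs =>
  ⟨w', a, fun _ _ h => h, hs, P.holds_future hw h⟩

theorem fupd_map {E₁ E₂ : Set ℕ} {P Q : IProp (WithInv M)} {n : ℕ} {w : World (WithInv M) n}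
    {a c : WithInv M} (h : (fupd E₁ E₂ P).holds n w a)
    (hPQ : ∀ {m : ℕ} {w' : World (WithInv M) m} {b : WithInv M}, Future w w' →
      RA.valid (b * c) → P.holds m w' b → Q.holds m w' (b * c)) :
    (fupd E₁ E₂ Q).holds n w (a * c) := by
  intro m w' f hm hw hs
  obtain ⟨w'', b, h1, h2, h3⟩ := h m w' (c * f) hm hw (by rwa [← mul_assoc a])
  rw [← mul_assoc b] at h2
  exact ⟨w'', b * c, h1, h2, hPQ (hw.trans (.ext h1))
    (RA.valid_of_mul _ f (RA.valid_mul_right h2.valid)) h3⟩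

theorem fupd_mono {E₁ E₂ : Set ℕ} {P Q : IProp (WithInv M)} (h : P ⊢ₛ Q) :
    fupd E₁ E₂ P ⊢ₛ fupd E₁ E₂ Q := fun n w a _ hP => by
  rw [← mul_one a]
  exact fupd_map hP fun _ hb hP' => by
    rw [mul_one] at hb ⊢
    exact h _ _ _ hb hP'

theorem fupd_trans {E₁ E₂ E₃ : Set ℕ} {P : IProp (WithInv M)} {n : ℕ} {w : World (WithInv M) n}
    {a : WithInv M} (h : (fupd E₁ E₂ (fupd E₂ E₃ P)).holds n w a) :
    (fupd E₁ E₃ P).holds n w a := by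
  intro m w' f hm hw hs
  obtain ⟨w₁, b, h1, h2, h3⟩ := h m w' f hm hw hs
  obtain ⟨w₂, c, h4, h5, h6⟩ := h3 m w₁ f hm (Future.refl _) h2
  exact ⟨w₂, c, fun i p hp => h4 i p (h1 i p hp), h5, h6⟩

/-- Keep the enabled tokens of `E`, and update the remaining resource. -/
theorem fupd_close {E : Set ℕ} {P : IProp (WithInv M)} {n : ℕ} {w : World (WithInv M) n}
    {a : WithInv M}
    (h : ∀ {m : ℕ} {w' : World (WithInv M) m}, Future w w' →
      RA.valid (enabled E * a) → P.holds m w' (enabled E * a)) :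
    (fupd E ∅ P).holds n w a := fun _ w' f _ hw hs =>
  ⟨w', enabled E * a, fun _ _ h => h, by rwa [enabled_empty, one_mul, mul_assoc],
    h hw (RA.valid_of_mul _ f (by rw [mul_assoc]; exact hs.valid))⟩

/-- Return the enabled tokens of `E`, and update the remaining resource. -/
theorem fupd_open {E E' : Set ℕ} {P : IProp (WithInv M)} {n : ℕ} {w : World (WithInv M) n}
    {a b : WithInv M} (hab : ∀ f, RA.valid (a * f) → RA.valid (b * f))
    (h : (fupd E E' P).holds n w b) : (fupd ∅ E' P).holds n w (enabled E * a) := by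
  intro m w' f hm hw hs
  refine h m w' f hm hw (hs.update fun g hg => ?_)
  rw [enabled_empty, one_mul] at hg
  have := hab (f * enabled E * g) (by convert hg using 1; ac_rfl)
  convert this using 1
  ac_rfl

end

end IProp

theorem IProp.Entails.refl {M : Type} [RA M] (P : IProp M) : P ⊢ₛ P := fun _ _ _ _ h => h

section Logic

variable {G : Type} [RA G] {C : MarkovChain}

/-! ## The coupling precondition and the weakest precondition -/

theorem execCouplF_mono {Z Z' : C.State → Conf → IProp (Res G C)}
    {Q Q' : C.State × Conf → IProp (Res G C)} (hZ : ∀ m ρ, Z m ρ ⊢ₛ Z' m ρ)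
    (hQ : ∀ s, Q s ⊢ₛ Q' s) (s : C.State × Conf) :
    execCouplF Z Q s ⊢ₛ execCouplF Z' Q' s := by
  intro n w a ha h
  rcases h with ⟨R, h⟩ | ⟨R, h⟩ | ⟨R, h⟩ | ⟨R, l, h⟩
  · rw [pure_sep_holds] at h
    exact .inl ⟨R, pure_sep_holds.2 ⟨h.1, fun m ρ hR =>
      fupd_mono (hZ m ρ) n w a ha (h.2 m ρ hR)⟩⟩
  · rw [pure_sep_holds] at h
    exact .inr (.inl ⟨R, pure_sep_holds.2 ⟨h.1, fun m ρ hR =>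
      later_mono (fupd_mono (hZ m ρ)) n w a ha (h.2 m ρ hR)⟩⟩)
  · rw [pure_sep_holds] at h
    exact .inr (.inr (.inl ⟨R, pure_sep_holds.2 ⟨h.1, fun m hR =>
      later_mono (fupd_mono (hQ _)) n w a ha (h.2 m hR)⟩⟩))
  · rw [pure_sep_holds] at h
    exact .inr (.inr (.inr ⟨R, l, pure_sep_holds.2 ⟨h.1, fun m σ hR =>
      later_mono (fupd_mono (hQ _)) n w a ha (h.2 m σ hR)⟩⟩))

theorem execCoupl_fold (Z : C.State → Conf → IProp (Res G C)) (s : C.State × Conf) :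
    execCouplF Z (lfp (execCouplF Z)) s ⊢ₛ lfp (execCouplF Z) s :=
  lfp_fold (fun _ _ h => execCouplF_mono (fun _ _ => .refl _) h) s

theorem execCoupl_mono {Z Z' : C.State → Conf → IProp (Res G C)} (hZ : ∀ m ρ, Z m ρ ⊢ₛ Z' m ρ)
    (m : C.State) (ρ : Conf) : execCoupl m ρ Z ⊢ₛ execCoupl m ρ Z' := by
  have key : ∀ s, execCouplF Z (lfp (execCouplF Z')) s ⊢ₛ lfp (execCouplF Z') s := by
    intro s n w a ha h
    refine execCoupl_fold Z' s n w a ha ?_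
    exact execCouplF_mono hZ (fun _ _ _ _ _ h => h) s n w a ha h
  exact lfp_induct key (m, ρ)

/-- The postcondition of a step in the weakest precondition. -/
def stepPost (E : Set ℕ) (W : Expr → IProp (Res G C)) (m : C.State) (ρ : Conf) :
    IProp (Res G C) :=
  fupd ∅ E (modelInterp m ∗ stateInterp ρ.2 ∗ W ρ.1)

theorem stepPost_mono {E : Set ℕ} {W W' : Expr → IProp (Res G C)} (h : ∀ e, W e ⊢ₛ W' e)
    (m : C.State) (ρ : Conf) : stepPost E W m ρ ⊢ₛ stepPost E W' m ρ :=
  fupd_mono (sep_mono (fun _ _ _ _ h => h) (sep_mono (fun _ _ _ _ h => h) (h _)))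

theorem rwpF_of_toVal_none {E : Set ℕ} {Φ : Val → IProp (Res G C)} {W : Expr → IProp (Res G C)}
    {e : Expr} (he : e.toVal = none) :
    rwpF E Φ W e = all fun σ : State => all fun m : C.State =>
      (modelInterp m ∗ stateInterp σ) -∗ fupd E ∅ (execCoupl m (e, σ) (stepPost E W)) := by
  simp only [rwpF, he]
  rfl

theorem rwpF_mono {E : Set ℕ} {Φ : Val → IProp (Res G C)} {W W' : Expr → IProp (Res G C)}
    (h : ∀ e, W e ⊢ₛ W' e) (e : Expr) : rwpF E Φ W e ⊢ₛ rwpF E Φ W' e := by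
  rcases he : e.toVal with _ | v
  · rw [rwpF_of_toVal_none he, rwpF_of_toVal_none he]
    intro n w a _ hW σ m k w' b hw hv hb
    exact fupd_mono (execCoupl_mono (stepPost_mono h) m (e, σ)) k w' (a * b) hv
      (hW σ m k w' b hw hv hb)
  · obtain rfl := Expr.eq_of_toVal he
    exact fun _ _ _ _ h => h

theorem rwp_fold {E : Set ℕ} {Φ : Val → IProp (Res G C)} (e : Expr) :
    rwpF E Φ (fun e => rwp E e Φ) e ⊢ₛ rwp E e Φ :=
  lfp_fold (fun _ _ => rwpF_mono) e

theorem rwp_unfold {E : Set ℕ} {Φ : Val → IProp (Res G C)} (e : Expr) :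
    rwp E e Φ ⊢ₛ rwpF E Φ (fun e => rwp E e Φ) e :=
  lfp_unfold (fun _ _ => rwpF_mono) e

/-- The authoritative views of the program state `σ` and the model state `m`. -/
def authRes (σ : State) (m : C.State) : Res G C :=
  (1, 1, .full fun l => σ.heap.lookup l, .full fun ι => σ.tapes.lookup ι,
    .full fun _ => some m, 1)

theorem authRes_eq_mul (σ : State) (m : C.State) : (authRes σ m : Res G C) =
    (1, 1, 1, 1, .full fun _ => some m, 1) *
      (1, 1, .full fun l => σ.heap.lookup l, .full fun ι => σ.tapes.lookup ι, 1, 1) := by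
  simp only [authRes, Prod.mk_mul_mk, mul_one, one_mul]

theorem interp_holds {σ : State} {m : C.State} {n : ℕ} {w : World _ n} {b : Res G C} :
    (modelInterp m ∗ stateInterp σ).holds n w b ↔ authRes σ m ∣ b := by
  constructor
  · rintro ⟨_, _, rfl, ⟨b, rfl⟩, ⟨c, rfl⟩⟩
    exact ⟨b * c, by rw [authRes_eq_mul]; exact mul_mul_mul_comm _ b _ c⟩
  · rintro ⟨b, rfl⟩
    exact ⟨(1, 1, 1, 1, .full fun _ => some m, 1),
      (1, 1, .full fun l => σ.heap.lookup l, .full fun ι => σ.tapes.lookup ι, 1, 1) * b,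
      by rw [authRes_eq_mul, mul_assoc], dvd_rfl, dvd_mul_right _ _⟩

theorem interp_sep_holds {P : IProp (Res G C)} {σ : State} {m : C.State} {n : ℕ} {w : World _ n}
    {a : Res G C} :
    (modelInterp m ∗ stateInterp σ ∗ P).holds n w a ↔
      ∃ b, a = authRes σ m * b ∧ P.holds n w b := by
  constructor
  · rintro ⟨b, _, rfl, hb, c, d, rfl, hc, hd⟩
    obtain ⟨f, hf⟩ := interp_holds.1 (⟨b, c, rfl, hb, hc⟩ :
      (modelInterp m ∗ stateInterp σ).holds n w (b * c))
    exact ⟨f * d, by rw [← mul_assoc, hf, mul_assoc], P.holds_dvd (dvd_mul_left d f) hd⟩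
  · rintro ⟨b, rfl, hb⟩
    obtain ⟨c, d, h, hc, hd⟩ := (interp_holds (w := w)).2 (dvd_refl (authRes (G := G) σ m))
    exact ⟨c, d * b, by rw [h, mul_assoc], hc, d, b, rfl, hd, hb⟩

theorem rwp_of_toVal_none {E : Set ℕ} {Φ : Val → IProp (Res G C)} {e : Expr}
    (he : e.toVal = none) {n : ℕ} {w : World _ n} {a : Res G C} (ha : RA.valid a)
    (h : ∀ (σ : State) (m : C.State) {k : ℕ} {w' : World (Res G C) k} {b : Res G C},
      Future w w' → RA.valid (authRes σ m * (a * b)) →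
        (fupd E ∅ (execCoupl m (e, σ) (stepPost E fun e => rwp E e Φ))).holds k w'
          (authRes σ m * (a * b))) :
    (rwp E e Φ).holds n w a := by
  refine rwp_fold e n w a ha ?_
  rw [rwpF_of_toVal_none he]
  intro σ m k w' b hw hv hb
  obtain ⟨g, rfl⟩ := interp_holds.1 hb
  rw [mul_left_comm] at hv ⊢
  exact h σ m hw hv

theorem fupd_execCoupl_of_rwp {E : Set ℕ} {Φ : Val → IProp (Res G C)} {e : Expr}
    (he : e.toVal = none) {n : ℕ} {w : World _ n} {a b : Res G C} {σ : State} {m : C.State}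
    (hv : RA.valid (authRes σ m * (a * b))) (h : (rwp E e Φ).holds n w a) :
    (fupd E ∅ (execCoupl m (e, σ) (stepPost E fun e => rwp E e Φ))).holds n w
      (authRes σ m * (a * b)) := by
  have ha : RA.valid a := RA.valid_of_mul a b (RA.valid_mul_right hv)
  have h' := rwp_unfold e n w a ha h
  rw [rwpF_of_toVal_none he] at h'
  rw [mul_left_comm] at hv ⊢
  exact h' σ m n w _ (Future.refl w) hv (interp_holds.2 (dvd_mul_right _ _))

theorem rwp_val {E : Set ℕ} {Φ : Val → IProp (Res G C)} {v : Val} {n : ℕ} {w : World _ n}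
    {a : Res G C} (ha : RA.valid a) (h : (Φ v).holds n w a) : (rwp E (.val v) Φ).holds n w a :=
  rwp_fold _ n w a ha (fupd_intro h)

/-- Needed in the bind rule when the bound expression is a value: its postcondition is then
available only under an update. -/
theorem rwp_of_fupd {E : Set ℕ} {Φ : Val → IProp (Res G C)} {e : Expr} {n : ℕ} {w : World _ n}
    {a : Res G C} (ha : RA.valid a) (h : (fupd E E (rwp E e Φ)).holds n w a) :
    (rwp E e Φ).holds n w a := by
  rcases he : e.toVal with _ | v
  · refine rwp_of_toVal_none he ha fun σ m k w' b hw hv => fupd_trans (E₂ := E) ?_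
    rw [mul_left_comm] at hv ⊢
    refine fupd_map (holds_future _ hw h) fun _ hv h' => ?_
    rw [mul_left_comm] at hv ⊢
    exact fupd_execCoupl_of_rwp he hv h'
  · obtain rfl := Expr.eq_of_toVal he
    exact rwp_fold _ n w a ha (fupd_trans (fupd_mono (rwp_unfold _) n w a ha h))

/-- Induction over the least fixed point. The resource `P` can be handed to the continuation in
every branch because only one branch is taken. The induction predicate assumes a nonvalue in the
hole; this persists because model and presampling steps leave the expression alone, and a program
step leaves the fixed point through `Z`. -/
theorem execCoupl_bind (K : Ectx) {Z Z' : C.State → Conf → IProp (Res G C)} {P : IProp (Res G C)}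
    (hZ : ∀ (m : C.State) (ρ : Conf), Z m ρ ⊢ₛ P -∗ Z' m (K.fill ρ.1, ρ.2)) (m : C.State)
    {e : Expr} (he : e.toVal = none) (σ : State) :
    execCoupl m (e, σ) Z ⊢ₛ P -∗ execCoupl m (K.fill e, σ) Z' := by
  have key : ∀ s : C.State × Conf, execCouplF Z (fun s => all fun _ : s.2.1.toVal = none =>
      P -∗ execCoupl s.1 (K.fill s.2.1, s.2.2) Z') s ⊢ₛ all fun _ : s.2.1.toVal = none =>
      P -∗ execCoupl s.1 (K.fill s.2.1, s.2.2) Z' := by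
    rintro ⟨m, e, σ⟩ n w a - h he k w' b hw hv hP
    replace h := holds_future _ hw h
    have hstep : prog.step (K.fill e, σ) = (prog.step (e, σ)).map fun ρ => (K.fill ρ.1, ρ.2) :=
      progStep_fill K he σ
    have hred : prog.Red (e, σ) → prog.Red (K.fill e, σ) := by
      rintro ⟨ρ, hρ⟩
      refine ⟨(K.fill ρ.1, ρ.2), ?_⟩
      rw [hstep]
      exact SubDist.map_mass_pos_of (fun ρ : Conf => ((K.fill ρ.1, ρ.2) : Conf)) hρ
    have hcoup : ∀ {μ : SubDist C.State} {R : C.State → Conf → Prop},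
        μ.Coupled (prog.step (e, σ)) R → μ.Coupled (prog.step (K.fill e, σ))
          fun m ρ' => ∃ ρ : Conf, ρ' = (K.fill ρ.1, ρ.2) ∧ R m ρ := by
      intro μ R h
      have := h.map id (fun ρ : Conf => ((K.fill ρ.1, ρ.2) : Conf))
      rw [show μ.map id = μ from μ.bind_ret] at this
      rw [hstep]
      exact this.mono fun m ρ' ⟨m', ρ, hm, hρ, hR⟩ => ⟨ρ, hρ, by rwa [hm]⟩
    have hfupd : ∀ {X Y : IProp (Res G C)}, (X ⊢ₛ P -∗ Y) → ∀ {j : ℕ} {u : World (Res G C) j},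
        Future w' u → (fupd ∅ ∅ X).holds j u a → (fupd ∅ ∅ Y).holds j u (a * b) := by
      intro X Y hXY j u hu h
      exact fupd_map h fun hu' hv h' => hXY _ _ _ (RA.valid_of_mul _ _ hv) h' _ _ _
        (Future.refl _) hv (holds_future _ (hu.trans hu') hP)
    refine execCoupl_fold Z' _ k w' _ hv ?_
    rcases h with ⟨R, h⟩ | ⟨R, h⟩ | ⟨R, h⟩ | ⟨R, l, h⟩
    · obtain ⟨⟨h1, h2⟩, h3⟩ := pure_sep_holds.1 h
      refine .inl ⟨_, pure_sep_holds.2 ⟨⟨hred h1, hcoup h2⟩, ?_⟩⟩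
      rintro m' _ ⟨ρ, rfl, hR⟩
      exact hfupd (hZ m' ρ) (Future.refl _) (h3 m' ρ hR)
    · obtain ⟨⟨h1, h1', h2⟩, h3⟩ := pure_sep_holds.1 h
      refine .inr (.inl ⟨_, pure_sep_holds.2 ⟨⟨hred h1, h1', hcoup h2⟩, ?_⟩⟩)
      rintro m' _ ⟨ρ, rfl, hR⟩
      exact laterHolds_map (h3 m' ρ hR) fun hu h' => hfupd (hZ m' ρ) hu h'
    · obtain ⟨⟨h1, h2⟩, h3⟩ := pure_sep_holds.1 h
      -- The relation forgets its second argument: the program is fixed at a Dirac mass, whose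
      -- location moves from `(e, σ)` to the filled configuration.
      refine .inr (.inr (.inl ⟨fun m _ => R m (e, σ), pure_sep_holds.2 ⟨⟨h1, ?_⟩, ?_⟩⟩))
      · exact h2.ret_right _
      · intro m' hR
        refine laterHolds_map (h3 m' hR) fun hu h' => hfupd ?_ hu h'
        exact fun n w a ha h => h he
    · obtain ⟨⟨h1, h1', h2⟩, h3⟩ := pure_sep_holds.1 h
      refine .inr (.inr (.inr ⟨R, l, pure_sep_holds.2 ⟨⟨h1, h1', h2⟩, ?_⟩⟩))
      intro m' σ' hR
      refine laterHolds_map (h3 m' σ' hR) fun hu h' => hfupd ?_ hu h'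
      exact fun n w a ha h => h he
  intro n w a ha h
  exact lfp_induct key (m, (e, σ)) n w a ha h he

/-- The bind rule, with the rule of consequence and the frame rule. -/
theorem rwp_bind (K : Ectx) {E : Set ℕ} {Φ Ψ : Val → IProp (Res G C)} (e : Expr) :
    rwp E e Ψ ⊢ₛ (all fun v => Ψ v -∗ rwp E (K.fill (.val v)) Φ) -∗ rwp E (K.fill e) Φ := by
  refine lfp_induct (Q := fun e => (all fun v => Ψ v -∗ rwp E (K.fill (.val v)) Φ) -∗
    rwp E (K.fill e) Φ) ?_ e
  intro e n w a ha h k w' b hw hv hb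
  replace h := holds_future _ hw h
  rcases he : e.toVal with _ | v
  · rw [rwpF_of_toVal_none he] at h
    refine rwp_of_toVal_none (K.toVal_fill he) hv fun σ m j u c hu hv' => ?_
    -- The inner weakest precondition is run with the additional frame `c`, and the continuation's
    -- resource `b` is kept aside until a value is reached.
    have e1 : authRes σ m * (a * b * c) = a * (authRes σ m * c) * b := by ac_rfl
    rw [e1] at hv' ⊢
    refine fupd_map (h σ m j u _ hu (RA.valid_of_mul _ _ hv')
      (interp_holds.2 (dvd_mul_right _ _))) fun hu' hv'' h' => ?_
    refine execCoupl_bind K ?_ m he σ _ _ _ (RA.valid_of_mul _ _ hv'') h' _ _ _ (Future.refl _)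
      hv'' (holds_future _ (hu.trans hu') hb)
    intro m' ρ j' u' a' _ hZ j'' u'' b' hu'' _ hb'
    refine fupd_map (holds_future _ hu'' hZ) fun hu₃ hv₃ h₃ => ?_
    obtain ⟨d, rfl, hd⟩ := interp_sep_holds.1 h₃
    rw [mul_assoc] at hv₃ ⊢
    refine interp_sep_holds.2 ⟨_, rfl, hd _ _ _ (Future.refl _) (RA.valid_mul_right hv₃)
      (holds_future _ hu₃ hb')⟩
  · obtain rfl := Expr.eq_of_toVal he
    refine rwp_of_fupd hv (fupd_map h fun hu hv' h' => ?_)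
    have := holds_future _ hu hb v _ _ _ (Future.refl _) (by rwa [mul_comm] at hv') h'
    rwa [mul_comm]

/-- A deterministic step of the program, with a frame-preserving update. -/
theorem rwp_prog_step {E : Set ℕ} {Φ : Val → IProp (Res G C)} {e : Expr} (he : e.toVal = none)
    {n : ℕ} {w : World _ n} {a : Res G C} (ha : RA.valid a)
    (h : ∀ (σ : State) (m : C.State), RA.valid (authRes σ m * a) →
      ∃ (e' : Expr) (σ' : State) (a' : Res G C), progStep (e, σ) = SubDist.ret (e', σ') ∧
        (∀ f, RA.valid (authRes σ m * (a * f)) → RA.valid (authRes σ' m * (a' * f))) ∧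
        (RA.valid a' → (rwp E e' Φ).holds n w a')) :
    (rwp E e Φ).holds n w a := by
  -- The mask has to become empty around the step. The enabled tokens are therefore carried as an
  -- ordinary resource by `fupd_close`, and given back afterwards by `fupd_open`.
  refine rwp_of_toVal_none he ha fun σ m k w' b hw hv => fupd_close fun {j u} hu hvE => ?_
  obtain ⟨e', σ', a', hs, hupd, hW⟩ := h σ m (RA.valid_of_mul _ b (by rwa [mul_assoc]))
  have hv' := hupd b hv
  replace hW := hW (RA.valid_of_mul _ b (RA.valid_mul_right hv'))
  have hstep : prog.step (e, σ) = SubDist.ret ((e', σ') : Conf) := hs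
  refine execCoupl_fold _ _ j u _ (hvE) (.inl
    ⟨fun m' ρ => m' = m ∧ ρ = (e', σ'), pure_sep_holds.2 ⟨⟨⟨(e', σ'), ?_⟩, by rw [hstep]; exact SubDist.coupled_ret _ _⟩, ?_⟩⟩)
  · rw [hstep, SubDist.ret_mass_self]
    exact one_pos
  · rintro m' _ ⟨hm, rfl⟩
    obtain rfl : m = m' := hm.symm
    refine fupd_intro (fupd_open (b := authRes σ' m * (a' * b)) (fun f hf => ?_) (fupd_intro
      (interp_sep_holds.2 ⟨_, rfl, holds_dvd _ (dvd_mul_right a' b)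
        (holds_future _ (hw.trans hu) hW)⟩)))
    rw [mul_assoc, mul_assoc] at hf ⊢
    exact hupd _ hf

/-- A step of the model coupled with presampling onto a tape, with a frame-preserving update. -/
theorem rwp_presample_step {E : Set ℕ} {Φ : Val → IProp (Res G C)} {e : Expr}
    (he : e.toVal = none) (ι : ℕ) {n : ℕ} {w : World _ n} {a : Res G C} (ha : RA.valid a)
    (h : ∀ (σ : State) (m : C.State), RA.valid (authRes σ m * a) →
      ∃ R : C.State → State → Prop, C.Red m ∧ ι ∈ σ.tapes ∧
        (C.step m).Coupled (σ.presample ι) R ∧ ∀ m' σ', R m' σ' → ∃ a' : Res G C,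
          (∀ f, RA.valid (authRes σ m * (a * f)) → RA.valid (authRes σ' m' * (a' * f))) ∧
          (RA.valid a' → (rwp E e Φ).laterHolds n w a')) :
    (rwp E e Φ).holds n w a := by
  refine rwp_of_toVal_none he ha fun σ m k w' b hw hv => fupd_close fun {j u} hu hvE => ?_
  obtain ⟨R, hred, hι, hR, hcont⟩ := h σ m (RA.valid_of_mul _ b (by rwa [mul_assoc]))
  refine execCoupl_fold _ _ j u _ (hvE) (.inr (.inr (.inr ⟨R, [ι],
    pure_sep_holds.2 ⟨⟨hred, by simpa using hι, ?_⟩, fun m' σ' hσ' => ?_⟩⟩)))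
  · rwa [State.presamples, show State.presamples [] = SubDist.ret from funext fun _ => rfl,
      SubDist.bind_ret]
  · obtain ⟨a', hupd, hW⟩ := hcont m' σ' hσ'
    have hv' := hupd b hv
    replace hW := hW (RA.valid_of_mul _ b (RA.valid_mul_right hv'))
    refine laterHolds_map ((later _).mono (hw.trans hu) dvd_rfl hW) fun hu' hW' => ?_
    refine fupd_open (b := authRes σ' m' * (a' * b)) (fun f hf => ?_)
      (fupd_execCoupl_of_rwp he hv' hW')
    rw [mul_assoc, mul_assoc] at hf ⊢
    exact hupd _ hf

end Logic

/-! ## Soundness of the weakest precondition -/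

section

variable {M : Type} [RA M]

/-- The meta-level property `φ k` of the step index `k` holds if there is a world at index `k`
in which the invariants hold. -/
def adequate (E : Set ℕ) (φ : ℕ → Prop) : IProp (WithInv M) :=
  ⟨fun _ w a => ∀ (k : ℕ) (w' : World (WithInv M) k) (f : WithInv M), 0 < k → Future w w' →
      WSat w' (enabled E * (a * f)) → φ k, by
    rintro n m w w' a b hw ⟨d, rfl⟩ h k u f hk hu hs
    exact h k u (d * f) hk (hw.trans hu) (by rwa [← mul_assoc a])⟩

/-- The conclusion is a meta-level statement about the index, so it survives passing back from the
updated world; the update keeps the index positive and fixed. -/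
theorem fupd_adequate (E₁ E₂ : Set ℕ) (φ : ℕ → Prop) :
    fupd (M := M) E₁ E₂ (adequate E₂ φ) ⊢ₛ adequate E₁ φ := by
  intro n w a _ h k w' f hk hw hs
  obtain ⟨w'', b, _, hs', h'⟩ := fupd_elim (holds_future _ hw h) hk hs
  exact h' k w'' f hk (Future.refl _) hs'

/-- Removing a later lowers the index by one; `WSat.lower` supplies the satisfied world there.
Positivity of the new index has to be assumed, because updates promise nothing at index zero. -/
theorem later_adequate (E : Set ℕ) (φ : ℕ → Prop) :
    later (adequate (M := M) E φ) ⊢ₛ adequate E fun k => ∀ j, k = j + 1 → 0 < j → φ j := by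
  rintro n w a _ h k w' f - hw hs j rfl hj
  have h' : (adequate E φ).holds j w'.lower a := (later (adequate E φ)).mono hw dvd_rfl h
  exact h' j w'.lower f hj (Future.refl _) hs.lower

end

section

variable {G : Type} [RA G] {C : MarkovChain}

/-- The termination bound at step index `k`. -/
def TermBound (m : C.State) (ρ : Conf) (k : ℕ) : Prop := C.termN (k - 1) m ≤ prog.execTerm ρ

/-- At index `k` only `k - 1` laters can be removed before reaching the uninformative index zero,
hence the shift in `TermBound`. At `k = 1` the bound is vacuous: a reducible state is not final and
stops within zero steps with probability zero. -/
theorem TermBound.of_step {m : C.State} {ρ : Conf} {k : ℕ} (hm : C.Red m) (hk : 0 < k)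
    (h : ∀ j, k = j + 1 → 0 < j → (C.step m).expect (C.termN (j - 1)) ≤ prog.execTerm ρ) :
    TermBound m ρ k := by
  obtain ⟨j, rfl⟩ := Nat.exists_eq_succ_of_ne_zero hk.ne'
  rcases j with _ | j
  · exact (C.termN_zero hm.not_final).trans_le zero_le
  · exact (C.termN_succ hm.not_final j).trans_le (h (j + 1) rfl j.succ_pos)

/-- The weakest precondition without a postcondition, for the termination probability only. -/
def termWP (e : Expr) : IProp (Res G C) :=
  all fun σ : State => all fun m : C.State =>
    (modelInterp m ∗ stateInterp σ) -∗ adequate Set.univ (TermBound m (e, σ))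

theorem stepPost_termWP (m : C.State) (ρ : Conf) :
    stepPost (G := G) Set.univ termWP m ρ ⊢ₛ adequate ∅ (TermBound m ρ) := by
  intro n w a ha h
  refine fupd_adequate ∅ Set.univ _ n w a ha (fupd_mono ?_ n w a ha h)
  intro n w a ha h
  obtain ⟨b, rfl, hb⟩ := interp_sep_holds.1 h
  rw [mul_comm] at ha ⊢
  exact hb ρ.2 m n w _ (Future.refl _) ha (interp_holds.2 dvd_rfl)

/-- The probabilistic heart of adequacy, with one case for each rule of the coupling precondition.
-/
theorem execCoupl_termWP (m : C.State) (ρ : Conf) :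
    execCoupl m ρ (stepPost (G := G) Set.univ termWP) ⊢ₛ adequate ∅ (TermBound m ρ) := by
  have key : ∀ s : C.State × Conf, execCouplF (stepPost (G := G) Set.univ termWP)
      (fun s => adequate ∅ (TermBound s.1 s.2)) s ⊢ₛ adequate ∅ (TermBound s.1 s.2) := by
    rintro ⟨m, ρ⟩ n w a ha h k w' f hk hw hs
    have hZ : ∀ (m' : C.State) (ρ' : Conf), (fupd ∅ ∅ (stepPost (G := G) Set.univ termWP m' ρ')) ⊢ₛ
        adequate ∅ (TermBound m' ρ') := fun m' ρ' n w a ha h =>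
      fupd_adequate ∅ ∅ _ n w a ha (fupd_mono (stepPost_termWP m' ρ') n w a ha h)
    have hlater : ∀ {X : IProp (Res G C)} {φ : ℕ → Prop}, (X ⊢ₛ adequate ∅ φ) →
        (later X).holds n w a → ∀ j, k = j + 1 → 0 < j → φ j := fun hX h =>
      later_adequate ∅ _ n w a ha (later_mono hX n w a ha h) k w' f hk hw hs
    rcases h with ⟨R, h⟩ | ⟨R, h⟩ | ⟨R, h⟩ | ⟨R, l, h⟩
    · obtain ⟨⟨-, h2⟩, h3⟩ := pure_sep_holds.1 h
      have := h2.expect_le (f := C.termN (k - 1)) (g := prog.execTerm) fun m' ρ' hR =>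
        hZ m' ρ' n w a ha (h3 m' ρ' hR) k w' f hk hw hs
      -- The model stands still, so the index does not have to drop. Chains of such steps are
      -- controlled by the outer induction over the least fixed point `rwp`.
      rw [SubDist.expect_ret] at this
      exact this.trans (prog.expect_step_le_execTerm ρ)
    · obtain ⟨⟨-, h1, h2⟩, h3⟩ := pure_sep_holds.1 h
      refine TermBound.of_step h1 hk fun j hj hj' => ?_
      exact (h2.expect_le fun m' ρ' hR => hlater (hZ m' ρ') (h3 m' ρ' hR) j hj hj').trans
        (prog.expect_step_le_execTerm ρ)
    · obtain ⟨⟨h1, h2⟩, h3⟩ := pure_sep_holds.1 h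
      refine TermBound.of_step h1 hk fun j hj hj' => ?_
      refine ((h2.ret_right ρ).expect_le (g := fun _ => prog.execTerm ρ)
        fun m' _ hR => ?_).trans_eq (SubDist.expect_ret _ _)
      exact hlater (fupd_adequate ∅ ∅ _) (h3 m' hR) j hj hj'
    · obtain ⟨⟨h1, h1', h2⟩, h3⟩ := pure_sep_holds.1 h
      refine TermBound.of_step h1 hk fun j hj hj' => ?_
      -- The presampled tapes all exist, so averaging over their new contents gives back the
      -- original termination probability.
      refine (h2.expect_le fun m' σ' hR => ?_).trans_eq (expect_presamples_execTerm ρ.1 h1')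
      exact hlater (fupd_adequate ∅ ∅ _) (h3 m' σ' hR) j hj hj'
  exact lfp_induct key (m, ρ)

/-- The postcondition can be discarded: a value already terminates with probability one, which
bounds any probability of the model. -/
theorem rwp_termWP {Φ : Val → IProp (Res G C)} (e : Expr) : rwp Set.univ e Φ ⊢ₛ termWP e := by
  refine lfp_induct (fun e => ?_) e
  intro n w a ha h σ m k w' b hw hv hb
  rcases he : e.toVal with _ | v
  · rw [rwpF_of_toVal_none he] at h
    exact fupd_adequate _ _ _ k w' _ hv (fupd_mono (execCoupl_termWP m (e, σ)) k w' _ hv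
      (h σ m k w' b hw hv hb))
  · obtain rfl := Expr.eq_of_toVal he
    intro j _ _ _ _ _
    exact (C.termN_le_one _ m).trans (prog.execTerm_of_final ⟨v, rfl⟩).ge

/-- The empty world. -/
def emptyWorld (M : Type) [RA M] (n : ℕ) : World M n := ⟨fun _ => none, by simp⟩

/-- With no invariants allocated, all enabled tokens are outside and all disabled tokens inside, so
they do not collide. -/
theorem wsat_emptyWorld {M : Type} [RA M] {n : ℕ} {a : M} (ha : RA.valid a) :
    WSat (emptyWorld (WithInv M) n) (enabled Set.univ * (1, 1, a)) := by
  have hd : (emptyWorld (WithInv M) n).dom = ∅ := by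
    ext i
    simp [FinWorld.dom, emptyWorld]
  refine ⟨∅, fun _ => 1, Finset.empty_subset _, ?_, fun i hi => ?_⟩
  · have : enabled (M := M) Set.univ * (1, 1, a) * (enabled ↑(∅ : Finset ℕ) *
        disabled (↑(∅ : Finset ℕ))ᶜ * ∏ i ∈ (emptyWorld (WithInv M) n).dom \ ∅, 1) =
        (fun _ => .ex (), fun _ => .ex (), a) := by
      rw [Finset.prod_const_one, mul_one, Finset.coe_empty, enabled_empty, one_mul]
      simp only [enabled, disabled, Set.mem_univ, if_true, Set.compl_empty, Prod.mk_mul_mk, mul_one,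
        one_mul]
    rw [this]
    exact ⟨fun _ => nofun, fun _ => nofun, ha⟩
  · simp [hd] at hi

/-- Adequacy: a weakest precondition that holds for a resource that is compatible with the
program state and the model state bounds the termination probability from below. -/
theorem execTerm_le_of_rwp {Φ : Val → IProp (Res G C)} {e : Expr} {σ : State} {m : C.State}
    {h : AuthMap ℕ Val} {t : AuthMap ℕ Tape} {s : AuthMap Unit C.State} {g : G}
    (hv : RA.valid (authRes σ m * (1, 1, h, t, s, g)))
    (hW : ∀ n, (rwp Set.univ e Φ).holds n (emptyWorld _ n) (1, 1, h, t, s, g)) :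
    C.execTerm m ≤ prog.execTerm (e, σ) := by
  rw [C.execTerm_eq_iSup]
  refine iSup_le fun n => ?_
  have h1 := rwp_termWP e _ _ _ (RA.valid_mul_right hv) (hW (n + 1))
  rw [mul_comm] at hv
  have h2 := h1 σ m _ _ _ (Future.refl _) hv (interp_holds.2 dvd_rfl)
  -- Index `n + 1` gives the bound for `n` model steps.
  refine h2 (n + 1) _ 1 n.succ_pos (Future.refl _) ?_
  have he : ((1, 1, h, t, s, g) * authRes σ m : Res G C) =
      (1, 1, ((1, 1, h, t, s, g) * authRes σ m : Res G C).2.2) := by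
    simp only [authRes, Prod.mk_mul_mk, mul_one]
  rw [mul_one, he]
  exact wsat_emptyWorld hv.2.2

end

/-! ## Updates of authoritative maps -/

theorem Excl.unit_mul {A : Type} (x : Excl A) : Excl.unit * x = x := one_mul x

theorem Excl.ex_mul_ne_bot {A : Type} {a : A} {x : Excl A} (h : Excl.ex a * x ≠ .bot) :
    x = .unit := by
  cases x
  · rfl
  · exact absurd rfl h
  · exact absurd rfl h

theorem Excl.ex_mul_unit {A : Type} (a : A) : Excl.ex a * Excl.unit = Excl.ex a := rfl

namespace AuthMap

variable {K V : Type}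

/-- Ownership of the entries of a map. -/
def ofMap (h : K → Option V) : AuthMap K V := ⟨1, fun k => (h k).elim .unit .ex⟩

theorem entry_eq_ofMap [DecidableEq K] (k : K) (v : V) :
    entry k v = ofMap (Function.update (fun _ => none) k (some v)) := by
  refine AuthMap.ext rfl (funext fun k' => ?_)
  rcases eq_or_ne k' k with rfl | hk
  · simp [entry, ofMap]
  · simp [entry, ofMap, hk, Excl.one_def]

/-- Reduces compatibility of the authoritative map `s`, the owned part `h` and a frame `f` to a
condition at each key. Lookup and frame-preserving updates are read off from it. -/
theorem valid_full_mul {s : K → Option V} {h : K → Option V} {f : AuthMap K V} :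
    RA.valid (full s * (ofMap h * f)) ↔ f.auth = .unit ∧ ∀ k,
      (∃ v, h k = some v ∧ s k = some v ∧ f.frag k = .unit) ∨
        h k = none ∧ f.frag k ≠ .bot ∧ ∀ v, f.frag k = .ex v → s k = some v := by
  have hauth : (full s * (ofMap h * f)).auth = .ex s * f.auth := by
    simp only [auth_mul, full, ofMap, one_mul]
  have hfrag : ∀ k, (full s * (ofMap h * f)).frag k = (h k).elim .unit .ex * f.frag k := by
    intro k
    simp only [frag_mul, full, ofMap, Pi.one_apply, one_mul]
  constructor
  · rintro ⟨h1, h2, h3⟩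
    rw [hauth] at h1
    have hf := Excl.ex_mul_ne_bot h1
    refine ⟨hf, fun k => ?_⟩
    have h2' := h2 k
    have h3' := h3 s (by rw [hauth, hf]; rfl) k
    rw [hfrag] at h2' h3'
    rcases hk : h k with _ | v
    · rw [hk] at h2' h3'
      exact .inr ⟨rfl, by rwa [Option.elim_none, Excl.unit_mul] at h2', fun v hv =>
        h3' v (by rwa [Option.elim_none, Excl.unit_mul])⟩
    · rw [hk] at h2' h3'
      have hu := Excl.ex_mul_ne_bot h2'
      exact .inl ⟨v, rfl, h3' v (by rw [hu]; rfl), hu⟩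
  · rintro ⟨h1, h2⟩
    refine ⟨by rw [hauth, h1]; exact nofun, fun k => ?_, fun s' hs k v => ?_⟩
    · rw [hfrag]
      obtain ⟨v, hk, -, hf⟩ | ⟨hk, hf, -⟩ := h2 k
      · rw [hk, hf]
        exact nofun
      · rwa [hk, Option.elim_none, Excl.unit_mul]
    · rw [hauth, h1, Excl.ex_mul_unit, Excl.ex.injEq] at hs
      subst hs
      rw [hfrag]
      obtain ⟨u, hk, hs, hf⟩ | ⟨hk, -, hf⟩ := h2 k
      · rw [hk, hf]
        rintro ⟨⟩
        exact hs
      · rw [hk, Option.elim_none, Excl.unit_mul]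
        exact hf v

theorem lookup_of_valid {s h : K → Option V} {f : AuthMap K V}
    (hv : RA.valid (full s * (ofMap h * f))) {k : K} {v : V} (hk : h k = some v) :
    s k = some v := by
  obtain ⟨u, hu, hs, -⟩ | ⟨hn, -⟩ := (valid_full_mul.1 hv).2 k
  · rw [hs, ← hu, hk]
  · rw [hk] at hn
    exact absurd hn nofun

/-- Both reasons why no frame can contradict the write: the key is owned, hence exclusively, or it
is absent from the authoritative map. The first serves stores, tape writes and model steps, the
second allocation. -/
theorem valid_update [DecidableEq K] {s h : K → Option V} {f : AuthMap K V}
    (hv : RA.valid (full s * (ofMap h * f))) {k : K} (hk : h k ≠ none ∨ s k = none) (v : V) :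
    RA.valid (full (Function.update s k (some v)) *
      (ofMap (Function.update h k (some v)) * f)) := by
  obtain ⟨h1, h2⟩ := valid_full_mul.1 hv
  refine valid_full_mul.2 ⟨h1, fun k' => ?_⟩
  rcases eq_or_ne k' k with rfl | hne
  · refine .inl ⟨v, by simp, by simp, ?_⟩
    obtain ⟨u, -, -, hf⟩ | ⟨hn, hb, hf⟩ := h2 k'
    · exact hf
    · rcases hk with hk | hk
      · exact absurd hn hk
      · rcases hf' : f.frag k' with _ | u | _
        · rfl
        · rw [hf u hf'] at hk
          exact absurd hk nofun
        · exact absurd hf' hb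
  · simp only [Function.update_of_ne hne]
    exact h2 k'

end AuthMap

/-! ## Pure reduction -/

/-- The contractum of a pure redex. -/
def Expr.contract : Expr → Option Expr
  | .fn f x e => some (.val (.recV f x e))
  | .app (.val (.recV f x e)) (.val v) => some (Expr.substB f (.recV f x e) (Expr.substB x v e))
  | .binop op (.val v₁) (.val v₂) => (op.eval v₁ v₂).map .val
  | .ite (.val (.lit (.bool b))) e₁ e₂ => some (if b then e₁ else e₂)
  | .pair (.val v₁) (.val v₂) => some (.val (.pairV v₁ v₂))
  | .fst (.val (.pairV v₁ _)) => some (.val v₁)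
  | .snd (.val (.pairV _ v₂)) => some (.val v₂)
  | .inl (.val v) => some (.val (.inlV v))
  | .inr (.val v) => some (.val (.inrV v))
  | .case (.val (.inlV v)) x e₁ _ _ => some (e₁.substB x v)
  | .case (.val (.inrV v)) _ _ y e₂ => some (e₂.substB y v)
  | _ => none

theorem Expr.headStep_of_contract {e e' : Expr} (h : e.contract = some e') (σ : State) :
    headStep σ e = SubDist.ret (e', σ) := by
  unfold Expr.contract at h
  split at h
  case h_3 =>
    simp only [headStep, h, pureStep]
  all_goals cases h <;> rfl

/-- A pure step in an evaluation context. -/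
def Expr.pureNext (e : Expr) : Option Expr := e.decomp.2.contract.map e.decomp.1.fill

/-- At most `n` pure steps. -/
def Expr.pureRun : ℕ → Expr → Expr
  | 0, e => e
  | n + 1, e => match e.pureNext with
    | some e' => e'.pureRun n
    | none => e

theorem Expr.pureNext_spec {e e' : Expr} (h : e.pureNext = some e') :
    e.toVal = none ∧ ∀ (K : Ectx) (σ : State),
      progStep (K.fill e, σ) = SubDist.ret (K.fill e', σ) := by
  obtain ⟨e₁, he₁, rfl⟩ := Option.map_eq_some_iff.1 h
  have he : e.toVal = none := by
    rcases hv : e.toVal with _ | v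
    · rfl
    · obtain rfl := Expr.eq_of_toVal hv
      exact absurd he₁ nofun
  refine ⟨he, fun K σ => ?_⟩
  rw [progStep_fill K he]
  simp only [progStep, headStep_of_contract he₁, SubDist.map_ret]

/-! ## Symbolic execution -/

section

variable {G : Type} [RA G] {C : MarkovChain}

/-- Ownership of the partial heap `h`, the tape `ι`, and the model state `m`. -/
def symRes (ι N : ℕ) (h : ℕ → Option Val) (ks : List (Fin (N + 1))) (m : C.State) : Res G C :=
  (1, 1, .ofMap h, .ofMap (Function.update (fun _ => none) ι (some ⟨N, ks⟩)),
    .ofMap (Function.update (fun _ => none) () (some m)), 1)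

/-- Validity is componentwise, so an update of the heap, the tape or the model can be checked
without looking at the other components. -/
theorem authRes_mul_symRes_valid {σ : State} {m' m : C.State} {ι N : ℕ} {h : ℕ → Option Val}
    {ks : List (Fin (N + 1))} {f : Res G C} :
    RA.valid (authRes σ m' * (symRes ι N h ks m * f)) ↔
      (RA.valid f.1 ∧ RA.valid f.2.1) ∧
      RA.valid (.full (fun l => σ.heap.lookup l) * (.ofMap h * f.2.2.1)) ∧
      RA.valid (.full (fun κ => σ.tapes.lookup κ) *
        (.ofMap (Function.update (fun _ => none) ι (some ⟨N, ks⟩)) * f.2.2.2.1)) ∧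
      RA.valid (.full (fun _ => some m') *
        (.ofMap (Function.update (fun _ => none) () (some m)) * f.2.2.2.2.1)) ∧
      RA.valid f.2.2.2.2.2 := by
  obtain ⟨f1, f2, f3, f4, f5, f6⟩ := f
  have : (authRes σ m' * (symRes ι N h ks m * (f1, f2, f3, f4, f5, f6)) : Res G C) =
      (f1, f2, .full (fun l => σ.heap.lookup l) * (.ofMap h * f3),
        .full (fun κ => σ.tapes.lookup κ) *
          (.ofMap (Function.update (fun _ => none) ι (some ⟨N, ks⟩)) * f4),
        .full (fun _ => some m') *
          (.ofMap (Function.update (fun _ => none) () (some m)) * f5), f6) := by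
    simp only [authRes, symRes, Prod.mk_mul_mk, one_mul]
  rw [this]
  exact ⟨fun ⟨h1, h2, h⟩ => ⟨⟨h1, h2⟩, h⟩, fun ⟨⟨h1, h2⟩, h⟩ => ⟨h1, h2, h⟩⟩

/-- The weakest precondition of `e` for the resources `symRes ι N h ks m` and the frame `c`. -/
def SymWP {n : ℕ} (w : World (Res G C) n) (c : Res G C) (ι N : ℕ) (m : C.State)
    (ks : List (Fin (N + 1))) (h : ℕ → Option Val) (e : Expr) : Prop :=
  RA.valid (c * symRes ι N h ks m) →
    (rwp Set.univ e fun _ => pure True).holds n w (c * symRes ι N h ks m)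

variable {n : ℕ} {w : World (Res G C) n} {c : Res G C} {ι N : ℕ} {m : C.State}
  {ks : List (Fin (N + 1))} {h : ℕ → Option Val} {K₀ K : Ectx} {e e' : Expr}

theorem symWP_val {v : Val} : SymWP w c ι N m ks h (.val v) := fun hv => rwp_val hv trivial

/-- Program steps during symbolic execution change at most the heap; the owned tape is read only
through the specification of `d`. -/
theorem SymWP.step (he : e.toVal = none)
    (H : ∀ σ : State, (∀ l v, h l = some v → σ.heap.lookup l = some v) →
      ∃ (e' : Expr) (σ' : State) (h' : ℕ → Option Val), progStep (e, σ) = SubDist.ret (e', σ') ∧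
        σ'.tapes = σ.tapes ∧
        (∀ f, RA.valid (AuthMap.full (fun l => σ.heap.lookup l) * (.ofMap h * f)) →
          RA.valid (AuthMap.full (fun l => σ'.heap.lookup l) * (.ofMap h' * f))) ∧
        SymWP w c ι N m ks h' e') :
    SymWP w c ι N m ks h e := by
  refine fun hv => rwp_prog_step he hv fun σ m' hv' => ?_
  rw [mul_comm c, authRes_mul_symRes_valid] at hv'
  obtain ⟨e', σ', h', hs, ht, hupd, hW⟩ :=
    H σ fun l v hl => AuthMap.lookup_of_valid hv'.2.1 hl
  refine ⟨e', σ', c * symRes ι N h' ks m, hs, fun f hf => ?_, hW⟩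
  rw [mul_comm c, mul_assoc, authRes_mul_symRes_valid] at hf ⊢
  rw [ht]
  exact ⟨hf.1, hupd _ hf.2.1, hf.2.2⟩

/-- Runs of pure steps become computations: the hypothesis `he'` is an equation between terms, to be
proved by simplification and independently of the logic and of the surrounding context. -/
theorem SymWP.pureRun (k : ℕ) (he' : e.pureRun k = e')
    (H : SymWP w c ι N m ks h (K₀.fill e')) : SymWP w c ι N m ks h (K₀.fill e) := by
  subst he'
  induction k generalizing e with
  | zero => exact H
  | succ k ih =>
    rcases he : e.pureNext with _ | e'
    · simpa only [Expr.pureRun, he] using H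
    · simp only [Expr.pureRun, he] at H
      obtain ⟨he, hs⟩ := Expr.pureNext_spec he
      exact .step (K₀.toVal_fill he) fun σ _ => ⟨_, σ, h, hs K₀ σ, rfl, fun _ h => h,
        ih H⟩

theorem decomp_nonval {e₀ : Expr} (hd : e.decomp = (K, e₀)) (he₀ : e₀.toVal = none) :
    e.toVal = none := by
  rcases hv : e.toVal with _ | v
  · rfl
  · obtain rfl := Expr.eq_of_toVal hv
    obtain ⟨-, rfl⟩ := Prod.mk.inj hd
    exact he₀

theorem progStep_decomp {e₀ e₁ : Expr} {σ σ' : State} (hd : e.decomp = (K, e₀))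
    (he₀ : e₀.toVal = none) (hs : headStep σ e₀ = SubDist.ret (e₁, σ')) (K₀ : Ectx) :
    progStep (K₀.fill e, σ) = SubDist.ret (K₀.fill (K.fill e₁), σ') := by
  rw [progStep_fill K₀ (decomp_nonval hd he₀)]
  simp only [progStep, hd, hs, SubDist.map_ret]

theorem SymWP.alloc {v : Val} (hd : e.decomp = (K, .alloc (.val v)))
    (H : ∀ l, h l = none → SymWP w c ι N m ks (Function.update h l (some v))
      (K₀.fill (K.fill (.val (.lit (.loc l)))))) :
    SymWP w c ι N m ks h (K₀.fill e) := by
  refine .step (K₀.toVal_fill (decomp_nonval hd rfl)) fun σ hσ => ?_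
  have hfresh : σ.heap.lookup (fresh σ.heap) = none :=
    Finmap.lookup_eq_none.2 (fresh_notMem σ.heap)
  refine ⟨_, _, _, progStep_decomp hd rfl rfl K₀, rfl, fun f hf => ?_, H (fresh σ.heap) ?_⟩
  · convert AuthMap.valid_update hf (.inr hfresh) v using 3
    funext l
    rcases eq_or_ne l (fresh σ.heap) with rfl | hl
    · simp
    · rw [Finmap.lookup_insert_of_ne _ hl, Function.update_of_ne hl]
  -- The new location is outside the actual heap, and the owned heap is part of the actual one.
  · by_contra hne
    obtain ⟨u, hu⟩ := Option.ne_none_iff_exists'.1 hne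
    rw [hσ _ _ hu] at hfresh
    exact absurd hfresh nofun

theorem SymWP.load {l : ℕ} {v : Val} (hd : e.decomp = (K, .load (.val (.lit (.loc l)))))
    (hl : h l = some v) (H : SymWP w c ι N m ks h (K₀.fill (K.fill (.val v)))) :
    SymWP w c ι N m ks h (K₀.fill e) := by
  refine .step (K₀.toVal_fill (decomp_nonval hd rfl)) fun σ hσ => ?_
  refine ⟨_, σ, h, progStep_decomp hd rfl ?_ K₀, rfl, fun _ h => h, H⟩
  simp only [headStep, hσ l v hl]
  rfl

theorem SymWP.store {l : ℕ} {v : Val}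
    (hd : e.decomp = (K, .store (.val (.lit (.loc l))) (.val v))) (hl : h l ≠ none)
    (H : SymWP w c ι N m ks (Function.update h l (some v))
      (K₀.fill (K.fill (.val (.lit .unit))))) :
    SymWP w c ι N m ks h (K₀.fill e) := by
  refine .step (K₀.toVal_fill (decomp_nonval hd rfl)) fun σ hσ => ?_
  obtain ⟨u, hu⟩ := Option.ne_none_iff_exists'.1 hl
  have hm : l ∈ σ.heap := Finmap.mem_iff.2 ⟨u, hσ l u hu⟩
  refine ⟨_, { σ with heap := σ.heap.insert l v }, _, progStep_decomp hd rfl ?_ K₀, rfl,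
    fun f hf => ?_, H⟩
  · simp only [headStep, hm, if_true]
  · convert AuthMap.valid_update hf (.inl hl) v using 3
    funext l'
    rcases eq_or_ne l' l with rfl | hl'
    · simp
    · rw [Finmap.lookup_insert_of_ne _ hl', Function.update_of_ne hl']

end

-- Focusing on a subterm and calling the sampler

section

variable {G : Type} [RA G] {C : MarkovChain} {n : ℕ} {w : World (Res G C) n} {c : Res G C}
  {ι N : ℕ} {m : C.State} {ks : List (Fin (N + 1))} {h : ℕ → Option Val} {K₀ K : Ectx}
  {e e' : Expr}

/-- Moves a frame of the current term into the outer context, so that lemmas about a call apply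
under any context. -/
theorem SymWP.focus {e₀ : Expr} (he : e = K.fill e₀)
    (H : SymWP w c ι N m ks h (Ectx.fill (K₀ ++ K) e₀)) :
    SymWP w c ι N m ks h (K₀.fill e) := by
  rw [he, ← Ectx.fill_append]
  exact H

theorem tape_holds {b : Res G C} : (tape ι N ks).holds n w b ↔
    ((1, 1, 1, .ofMap (Function.update (fun _ => none) ι (some ⟨N, ks⟩)), 1, 1) : Res G C) ∣ b := by
  rw [← AuthMap.entry_eq_ofMap]
  rfl

theorem spec_holds {b : Res G C} : (spec m).holds n w b ↔
    ((1, 1, 1, 1, .ofMap (Function.update (fun _ => none) () (some m)), 1) : Res G C) ∣ b := by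
  rw [← AuthMap.entry_eq_ofMap]
  rfl

theorem symRes_eq_mul : (symRes ι N h ks m : Res G C) =
    (1, 1, 1, .ofMap (Function.update (fun _ => none) ι (some ⟨N, ks⟩)), 1, 1) *
      (1, 1, .ofMap h, 1, .ofMap (Function.update (fun _ => none) () (some m)), 1) := by
  simp only [symRes, Prod.mk_mul_mk, one_mul, mul_one]

/-- The specification of the sampler holds for the resource `c`. -/
def SamplerSpec (w : World (Res G C) n) (c : Res G C) (ι N : ℕ) (d : Val) : Prop :=
  ∀ k : Fin (N + 1), (tape ι N [k] -∗ rwp Set.univ (.app (.val d) .tt) fun v =>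
    pure (v = Val.ofFin k) ∗ tape ι N []).holds n w c

/-- Idempotence of `c`, which stands for the core behind the boxed triples of `d`, allows one copy
to be spent on the call and another to be kept. Heap and model state are framed around the call, and
the tape comes back empty. -/
theorem SymWP.sample {d : Val} (hc : c * c = c) (hd : SamplerSpec w c ι N d) {k : Fin (N + 1)}
    (H : SymWP w c ι N m [] h (K₀.fill (.val (.ofFin k)))) :
    SymWP w c ι N m [k] h (K₀.fill (.app (.val d) .tt)) := by
  intro hv
  have hsplit : ∀ x y : Res G C, c * (x * y) = c * x * (c * y) := fun x y => by
    conv_lhs => rw [← hc]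
    ac_rfl
  rw [symRes_eq_mul, hsplit] at hv ⊢
  have hv' := RA.valid_of_mul _ _ hv
  refine rwp_bind K₀ (Ψ := fun v => pure (v = Val.ofFin k) ∗ tape ι N []) _ n w _ hv'
    (hd k n w _ (Future.refl w) hv' (tape_holds.2 dvd_rfl)) n w _ (Future.refl w) hv ?_
  intro v j w' b hw hvb hb
  obtain ⟨rfl, hb'⟩ := pure_sep_holds.1 hb
  obtain ⟨f, rfl⟩ := (tape_holds (C := C) (w := w')).1 hb'
  refine holds_future _ hw (holds_dvd _ (a := c * symRes ι N h [] m) ⟨f, ?_⟩ (H ?_))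
  · rw [symRes_eq_mul]
    ac_rfl
  · rw [symRes_eq_mul]
    refine RA.valid_of_dvd ⟨f, ?_⟩ hvb
    ac_rfl

end

-- The random walk coupled with presampling

section

variable {G : Type} [RA G] {N : ℕ}

theorem unif_mass_pos (N : ℕ) (k : Fin (N + 1)) : 0 < (SubDist.unif N).mass k :=
  ENNReal.inv_pos.2 (ENNReal.natCast_ne_top _)

/-- The state `m` of the random walk. -/
def gwState (N m : ℕ) : (gwWalk (unifNat N)).State := m

theorem gwWalk_step_succ (m : ℕ) : (gwWalk (unifNat N)).step (gwState N (m + 1)) =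
    (SubDist.unif N).map fun k : Fin (N + 1) => gwState N (m + (k : ℕ)) :=
  SubDist.map_map _ _ _

theorem gwWalk_red (m : ℕ) : (gwWalk (unifNat N)).Red (gwState N (m + 1)) := by
  refine ⟨gwState N (m + ((0 : Fin (N + 1)) : ℕ)), ?_⟩
  rw [gwWalk_step_succ]
  exact SubDist.map_mass_pos_of (fun k : Fin (N + 1) => gwState N (m + (k : ℕ))) (unif_mass_pos N 0)

/-- The same uniform `k` drives both sides: the walk moves by it and the tape stores it. The rest is
needed only under a later, and it is this later that drives the induction for the loop. -/
theorem SymWP.presample {n : ℕ} {w : World (Res G (gwWalk (unifNat N))) n}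
    {c : Res G (gwWalk (unifNat N))} {ι : ℕ} {m : ℕ} {h : ℕ → Option Val} {e : Expr}
    (he : e.toVal = none)
    (H : ∀ k : Fin (N + 1), RA.valid (c * symRes ι N h [k] (gwState N (m + k))) →
      (rwp Set.univ e fun _ => pure True).laterHolds n w
        (c * symRes ι N h [k] (gwState N (m + k)))) :
    SymWP w c ι N (gwState N (m + 1)) [] h e := by
  refine fun hv => rwp_presample_step he ι hv fun σ m' hv' => ?_
  rw [mul_comm c, authRes_mul_symRes_valid] at hv'
  have ht : σ.tapes.lookup ι = some ⟨N, []⟩ := AuthMap.lookup_of_valid hv'.2.2.1 (by simp)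
  -- Ownership of the model's single entry forces the actual model state to be the owned one.
  obtain rfl : m' = gwState N (m + 1) :=
    Option.some.inj (AuthMap.lookup_of_valid hv'.2.2.2.1 (k := ()) (by simp))
  refine ⟨_, gwWalk_red m, Finmap.mem_iff.2 ⟨_, ht⟩, by
    rw [gwWalk_step_succ, State.presample_of_lookup ht]
    exact SubDist.coupled_map_map _ _ _, ?_⟩
  rintro _ _ ⟨k, rfl, rfl⟩
  refine ⟨_, fun f hf => ?_, H k⟩
  rw [mul_comm c, mul_assoc, authRes_mul_symRes_valid] at hf ⊢
  refine ⟨hf.1, hf.2.1, ?_, ?_, hf.2.2.2.2⟩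
  · convert AuthMap.valid_update hf.2.2.1 (k := ι) (.inl (by simp)) ⟨N, [k]⟩ using 3
    · funext κ
      rcases eq_or_ne κ ι with rfl | hκ
      · rw [State.lookup_setTape, Function.update_self]
        rfl
      · rw [Function.update_of_ne hκ]
        exact Finmap.lookup_insert_of_ne _ hκ
    · rw [Function.update_idem]
  · convert AuthMap.valid_update hf.2.2.2.1 (k := ()) (.inl (by simp)) (gwState N (m + k)) using 3
    · funext u
      simp
    · rw [Function.update_idem]

end

/-! ## The sampler -/

open _root_.GWLogic.Expr

/-- A list of values, as a value. -/
def listVal : List Val → Val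
  | [] => .inlV (.lit .unit)
  | v :: vs => .inrV (.pairV v (listVal vs))

/-- The function that creates a child. -/
def childFn (d : Val) (s : ℕ) : Val :=
  .recV none none
    (letIn xR' (alloc none')
      (seq
        (app (app (val stackAdd)
          (app (app (app (val sampleNode) (val d)) (var xR')) (val (.lit (.loc s)))))
            (val (.lit (.loc s))))
        (var xR')))

/-- The task of sampling a node into the reference `r`, with stack `s`. -/
def task (d : Val) (s r : ℕ) : Val :=
  .recV none none
    (letIn xN (app (val d) tt)
      (letIn xF
        (lam none
          (letIn xR' (alloc none')
            (seq
              (app (app (val stackAdd)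
                (app (app (app (val sampleNode) (val d)) (var xR')) (val (.lit (.loc s)))))
                  (val (.lit (.loc s))))
              (var xR'))))
        (store (val (.lit (.loc r))) (app (app (val listInit) (var xN)) (var xF)))))

/-- The loop of `List.init`. -/
def listInitLoop (k : ℤ) (f : Val) : Val :=
  .recV (some xAux) (some xI)
    (ite (binop .eq (var xI) (val (.lit (.int k)))) none'
      (letIn xV (app (val f) (var xI))
        (letIn xTl (app (var xAux) (binop .add (var xI) (val (.lit (.int 1)))))
          (cons (var xV) (var xTl)))))

/-- The stack `s` contains the tasks for the allocated references `rs`. -/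
def StackInv (d : Val) (s : ℕ) (h : ℕ → Option Val) (rs : List ℕ) : Prop :=
  h s = some (listVal (rs.map (task d s))) ∧ ∀ r ∈ rs, h r ≠ none ∧ r ≠ s

theorem update_ne_none {h : ℕ → Option Val} {l l' : ℕ} {v : Val} (hl : h l ≠ none) :
    Function.update h l' (some v) l ≠ none := by
  rcases eq_or_ne l l' with rfl | hne
  · simp
  · rwa [Function.update_of_ne hne]

-- Pure reductions of the sampler's code

section

attribute [local simp] pureRun pureNext decomp decomp₁ decomp₂ Ectx.fill Frame.fill toVal contract
  substB subst Frame.push lam letIn seq tt none' some' cons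

/-- Applying `sampleNode` to all but its unit argument only builds a closure; nothing is sampled
until the task is run. In this and the following lemmas the number of steps is chosen to stop where
a heap operation or a call with a lemma of its own takes over. -/
theorem pureRun_sampleNode (d : Val) (r s : ℕ) :
    (app (app (app (val sampleNode) (val d)) (val (.lit (.loc r)))) (val (.lit (.loc s)))).pureRun
      6 = val (task d s r) := by
  simp [sampleNode, task]

theorem pureRun_stackAdd (v : Val) (s : ℕ) :
    (app (app (val stackAdd) (val v)) (val (.lit (.loc s)))).pureRun 3 =
      store (val (.lit (.loc s))) (cons (val v) (load (val (.lit (.loc s))))) := by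
  simp [stackAdd]

theorem pureRun_store_cons (s : ℕ) (v vs : Val) :
    (store (val (.lit (.loc s))) (cons (val v) (val vs))).pureRun 2 =
      store (val (.lit (.loc s))) (val (.inrV (.pairV v vs))) := by
  simp

theorem pureRun_childFn (d : Val) (s : ℕ) (v : Val) :
    (app (val (childFn d s)) (val v)).pureRun 2 =
      letIn xR' (alloc (val (.inlV (.lit .unit))))
        (seq
          (app (app (val stackAdd)
            (app (app (app (val sampleNode) (val d)) (var xR')) (val (.lit (.loc s)))))
              (val (.lit (.loc s))))
          (var xR')) := by
  simp [childFn]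

theorem pureRun_childFn_body (d : Val) (s r : ℕ) :
    (letIn xR' (val (.lit (.loc r)))
        (seq
          (app (app (val stackAdd)
            (app (app (app (val sampleNode) (val d)) (var xR')) (val (.lit (.loc s)))))
              (val (.lit (.loc s))))
          (var xR'))).pureRun 2 =
      seq
        (app (app (val stackAdd)
          (app (app (app (val sampleNode) (val d)) (val (.lit (.loc r)))) (val (.lit (.loc s)))))
            (val (.lit (.loc s))))
        (val (.lit (.loc r))) := by
  simp

theorem pureRun_seq (v : Val) (e : Expr) : (seq (val v) e).pureRun 2 = e := by
  simp

theorem pureRun_listInitLoop (i k : ℤ) (f : Val) :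
    (app (val (listInitLoop k f)) (val (.lit (.int i)))).pureRun 3 =
      if i = k then none' else
        letIn xV (app (val f) (val (.lit (.int i))))
          (letIn xTl (app (val (listInitLoop k f)) (binop .add (val (.lit (.int i)))
            (val (.lit (.int 1))))) (cons (var xV) (var xTl))) := by
  simp [listInitLoop, BinOp.eval]

theorem pureRun_listInitLoop_tail (i k : ℤ) (f v : Val) :
    (letIn xV (val v) (letIn xTl (app (val (listInitLoop k f)) (binop .add (val (.lit (.int i)))
      (val (.lit (.int 1))))) (cons (var xV) (var xTl)))).pureRun 3 =
      letIn xTl (app (val (listInitLoop k f)) (val (.lit (.int (i + 1))))) (cons (val v)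
        (var xTl)) := by
  simp [BinOp.eval]

theorem pureRun_letIn_cons (v vs : Val) : (letIn xTl (val vs) (cons (val v) (var xTl))).pureRun 4 =
    val (.inrV (.pairV v vs)) := by
  simp

theorem pureRun_none : none'.pureRun 1 = val (.inlV (.lit .unit)) := by
  simp

theorem pureRun_task (d : Val) (s r : ℕ) (v : Val) :
    (app (val (task d s r)) (val v)).pureRun 1 =
      letIn xN (app (val d) tt)
      (letIn xF
        (lam none
          (letIn xR' (alloc none')
            (seq
              (app (app (val stackAdd)
                (app (app (app (val sampleNode) (val d)) (var xR')) (val (.lit (.loc s)))))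
                  (val (.lit (.loc s))))
              (var xR'))))
        (store (val (.lit (.loc r))) (app (app (val listInit) (var xN)) (var xF)))) := by
  simp [task]

theorem pureRun_task_body (d : Val) (s r : ℕ) (k : ℤ) :
    (letIn xN (val (.lit (.int k)))
      (letIn xF
        (lam none
          (letIn xR' (alloc none')
            (seq
              (app (app (val stackAdd)
                (app (app (app (val sampleNode) (val d)) (var xR')) (val (.lit (.loc s)))))
                  (val (.lit (.loc s))))
              (var xR'))))
        (store (val (.lit (.loc r))) (app (app (val listInit) (var xN)) (var xF))))).pureRun 9 =
      store (val (.lit (.loc r))) (app (val (listInitLoop k (childFn d s)))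
        (val (.lit (.int 0)))) := by
  simp [childFn, listInitLoop, listInit]

theorem pureRun_run (s : ℕ) : (app (val run) (val (.lit (.loc s)))).pureRun 2 =
    case (case (load (val (.lit (.loc s)))) none none' (some xP)
      (seq (store (val (.lit (.loc s))) (snd (var xP))) (some' (fst (var xP)))))
      none tt (some xF) (seq (app (var xF) tt) (app (val run) (val (.lit (.loc s))))) := by
  simp [run, stackTake]

theorem pureRun_run_nil (s : ℕ) :
    (case (case (val (listVal [])) none none' (some xP)
      (seq (store (val (.lit (.loc s))) (snd (var xP))) (some' (fst (var xP)))))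
      none tt (some xF) (seq (app (var xF) tt)
        (app (val run) (val (.lit (.loc s)))))).pureRun 3 = tt := by
  simp [listVal]

theorem pureRun_run_cons (s : ℕ) (v : Val) (vs : List Val) :
    (case (case (val (listVal (v :: vs))) none none' (some xP)
      (seq (store (val (.lit (.loc s))) (snd (var xP))) (some' (fst (var xP)))))
      none tt (some xF) (seq (app (var xF) tt)
        (app (val run) (val (.lit (.loc s)))))).pureRun 2 =
    case (seq (store (val (.lit (.loc s))) (val (listVal vs)))
      (some' (fst (val (.pairV v (listVal vs))))))
      none tt (some xF) (seq (app (var xF) tt) (app (val run) (val (.lit (.loc s))))) := by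
  simp [listVal]

theorem pureRun_run_some (s : ℕ) (v v' u : Val) :
    (case (seq (val u) (some' (fst (val (.pairV v v'))))) none tt (some xF)
      (seq (app (var xF) tt) (app (val run) (val (.lit (.loc s)))))).pureRun 5 =
    seq (app (val v) tt) (app (val run) (val (.lit (.loc s)))) := by
  simp

theorem pureRun_genTree (d : Val) : (app (val genTree) (val d)).pureRun 2 =
    letIn xR (alloc (val (.inlV (.lit .unit))))
      (letIn xS (app (val stackCreate) tt)
        (seq
          (app (app (val stackAdd)
            (app (app (app (val sampleNode) (val d)) (var xR)) (var xS))) (var xS))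
          (seq (app (val run) (var xS)) (load (var xR))))) := by
  simp [genTree]

theorem pureRun_genTree_root (d : Val) (r : ℕ) :
    (letIn xR (val (.lit (.loc r)))
      (letIn xS (app (val stackCreate) tt)
        (seq
          (app (app (val stackAdd)
            (app (app (app (val sampleNode) (val d)) (var xR)) (var xS))) (var xS))
          (seq (app (val run) (var xS)) (load (var xR)))))).pureRun 4 =
      letIn xS (alloc (val (.inlV (.lit .unit))))
        (seq
          (app (app (val stackAdd)
            (app (app (app (val sampleNode) (val d)) (val (.lit (.loc r)))) (var xS))) (var xS))
          (seq (app (val run) (var xS)) (load (val (.lit (.loc r)))))) := by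
  simp [stackCreate]

theorem pureRun_genTree_stack (d : Val) (r s : ℕ) :
    (letIn xS (val (.lit (.loc s)))
        (seq
          (app (app (val stackAdd)
            (app (app (app (val sampleNode) (val d)) (val (.lit (.loc r)))) (var xS))) (var xS))
          (seq (app (val run) (var xS)) (load (val (.lit (.loc r))))))).pureRun 2 =
      seq
        (app (app (val stackAdd)
          (app (app (app (val sampleNode) (val d)) (val (.lit (.loc r)))) (val (.lit (.loc s)))))
          (val (.lit (.loc s))))
        (seq (app (val run) (val (.lit (.loc s)))) (load (val (.lit (.loc r))))) := by
  simp

end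

-- Symbolic execution of one task

section

variable {G : Type} [RA G] {C : MarkovChain} {n : ℕ} {w : World (Res G C) n} {c : Res G C}
  {ι N : ℕ} {m : C.State} {ks : List (Fin (N + 1))} {h : ℕ → Option Val} {K₀ : Ectx}
  {d : Val} {r s : ℕ} {rs : List ℕ}

theorem symWP_stackAdd {v : Val} {vs : List Val} (hs : h s = some (listVal vs))
    (H : SymWP w c ι N m ks (Function.update h s (some (listVal (v :: vs))))
      (K₀.fill (val (.lit .unit)))) :
    SymWP w c ι N m ks h
      (K₀.fill (app (app (val stackAdd) (val v)) (val (.lit (.loc s))))) := by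
  refine .pureRun 3 (pureRun_stackAdd v s) (.load rfl hs ?_)
  refine .pureRun 2 (pureRun_store_cons s v _) (.store (v := listVal (v :: vs)) rfl ?_ H)
  rw [hs]
  exact nofun

theorem symWP_addTask (hs : StackInv d s h rs) (hr : h r ≠ none) (hrs : r ≠ s)
    (H : ∀ h' : ℕ → Option Val, StackInv d s h' (r :: rs) → (∀ l, h l ≠ none → h' l ≠ none) →
      SymWP w c ι N m ks h' (K₀.fill (val (.lit .unit)))) :
    SymWP w c ι N m ks h (K₀.fill (app (app (val stackAdd)
      (app (app (app (val sampleNode) (val d)) (val (.lit (.loc r)))) (val (.lit (.loc s)))))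
        (val (.lit (.loc s))))) := by
  refine .focus (K := [.appL _, .appR _])
    (e₀ := app (app (app (val sampleNode) (val d)) (val (.lit (.loc r)))) (val (.lit (.loc s)))) rfl
    (.pureRun 6 (pureRun_sampleNode d r s) ?_)
  rw [Ectx.fill_append]
  refine symWP_stackAdd (vs := rs.map (task d s)) hs.1 (H _ ⟨by simp, fun r' hr' => ?_⟩ fun l hl =>
    update_ne_none hl)
  rcases List.mem_cons.1 hr' with rfl | hr'
  · exact ⟨update_ne_none hr, hrs⟩
  · exact ⟨update_ne_none (hs.2 r' hr').1, (hs.2 r' hr').2⟩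

/-- Each call adds one task to the stack, whatever its argument. Allocated locations stay allocated,
which is recorded for the later writes to the parents' references. -/
theorem symWP_childFn {v : Val} (hs : StackInv d s h rs)
    (H : ∀ (h' : ℕ → Option Val) (r : ℕ), StackInv d s h' (r :: rs) →
      (∀ l, h l ≠ none → h' l ≠ none) → SymWP w c ι N m ks h' (K₀.fill (val (.lit (.loc r))))) :
    SymWP w c ι N m ks h (K₀.fill (app (val (childFn d s)) (val v))) := by
  refine .pureRun 2 (pureRun_childFn d s v) (.alloc rfl fun r hr => ?_)
  have hrs : r ≠ s := by
    rintro rfl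
    rw [hs.1] at hr
    exact absurd hr nofun
  refine .pureRun 2 (pureRun_childFn_body d s r) (.focus (K := [.appR _])
    (e₀ := app (app (val stackAdd) (app (app (app (val sampleNode) (val d))
      (val (.lit (.loc r)))) (val (.lit (.loc s))))) (val (.lit (.loc s)))) rfl
    (symWP_addTask (rs := rs) ⟨?_, fun r' hr' => ?_⟩ (by simp) hrs fun h' hs' hh' => ?_))
  · rw [Function.update_of_ne hrs.symm, hs.1]
  · exact ⟨update_ne_none (hs.2 r' hr').1, (hs.2 r' hr').2⟩
  · rw [Ectx.fill_append]
    exact .pureRun 2 (pureRun_seq _ _) (H h' r hs' fun l hl => hh' l (update_ne_none hl))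

/-- Here `j` counts the remaining iterations, each of which adds one task. The resulting list is
irrelevant for termination, so its value is left arbitrary. -/
theorem symWP_listInitLoop (j : ℕ) {i k : ℤ} (hi : i + j = k) (hs : StackInv d s h rs)
    (H : ∀ (h' : ℕ → Option Val) (rs' : List ℕ) (v : Val), StackInv d s h' rs' →
      rs'.length = rs.length + j → (∀ l, h l ≠ none → h' l ≠ none) →
      SymWP w c ι N m ks h' (K₀.fill (val v))) :
    SymWP w c ι N m ks h
      (K₀.fill (app (val (listInitLoop k (childFn d s))) (val (.lit (.int i))))) := by
  refine .pureRun 3 (pureRun_listInitLoop i k _) ?_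
  -- The context varies as well, since the recursive call happens inside the binding that prepends
  -- the current element.
  induction j generalizing i h rs K₀ with
  | zero =>
    rw [if_pos (by simpa using hi)]
    exact .pureRun 1 pureRun_none (H h rs _ hs rfl fun _ h => h)
  | succ j ih =>
    rw [if_neg (by omega)]
    refine .focus (K := [.appR _]) (e₀ := app (val (childFn d s)) (val (.lit (.int i)))) rfl
      (symWP_childFn hs fun h₁ r hs₁ hh₁ => ?_)
    rw [Ectx.fill_append]
    refine .pureRun 3 (pureRun_listInitLoop_tail i k _ _) (.focus (K := [.appR _])
      (e₀ := app (val (listInitLoop k (childFn d s))) (val (.lit (.int (i + 1))))) rfl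
      (.pureRun 3 (pureRun_listInitLoop _ k _)
        (ih (by push_cast at hi; omega) hs₁ fun h₂ rs₂ v hs₂ hl hh₂ => ?_)))
    rw [Ectx.fill_append]
    exact .pureRun 4 (pureRun_letIn_cons _ v) (H h₂ rs₂ _ hs₂
      (by rw [hl, List.length_cons]; omega) fun l hl => hh₂ l (hh₁ l hl))

/-- The value `k` waiting on the tape is the number of tasks added. The final store needs `r` to be
allocated, and `r ≠ s` ensures that it does not overwrite the stack. -/
theorem symWP_task (hc : c * c = c) (hd : SamplerSpec w c ι N d) {k : Fin (N + 1)} {v : Val}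
    (hs : StackInv d s h rs) (hr : h r ≠ none) (hrs : r ≠ s)
    (H : ∀ (h' : ℕ → Option Val) (rs' : List ℕ), StackInv d s h' rs' →
      rs'.length = rs.length + k → (∀ l, h l ≠ none → h' l ≠ none) →
      SymWP w c ι N m [] h' (K₀.fill (val (.lit .unit)))) :
    SymWP w c ι N m [k] h (K₀.fill (app (val (task d s r)) (val v))) := by
  refine .pureRun 1 (pureRun_task d s r v) (.focus (K := [.appR _]) (e₀ := app (val d) tt) rfl
    (.sample hc hd ?_))
  rw [Ectx.fill_append]
  refine .pureRun 9 (pureRun_task_body d s r k) (.focus (K := [.storeR _])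
    (e₀ := app (val (listInitLoop k (childFn d s))) (val (.lit (.int 0)))) rfl
    (symWP_listInitLoop k (by simp) hs fun h' rs' v hs' hl hh' => ?_))
  rw [Ectx.fill_append]
  refine .store (v := v) (K := []) rfl (hh' r hr) (H _ rs' ⟨?_, fun r' hr' => ?_⟩ hl fun l hl =>
    update_ne_none (hh' l hl))
  · rw [Function.update_of_ne hrs.symm, hs'.1]
  · exact ⟨update_ne_none (hs'.2 r' hr').1, (hs'.2 r' hr').2⟩

end

-- The loop and the whole program

section

variable {G : Type} [RA G] {N : ℕ} {c : Res G (gwWalk (unifNat N))} {ι : ℕ} {d : Val} {s : ℕ}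

theorem SamplerSpec.future {n k : ℕ} {w : World (Res G (gwWalk (unifNat N))) n}
    {w' : World (Res G (gwWalk (unifNat N))) k} (hw : Future w w') (h : SamplerSpec w c ι N d) :
    SamplerSpec w' c ι N d := fun j => holds_future _ hw (h j)

/-- Löb induction, as induction on the step index. The loop invariant is that the walk's state
equals the length of the stack. The set `D` collects locations that the continuation still needs;
since worlds change during the loop, `H` is assumed for all of them. -/
theorem symWP_run (hc : c * c = c) {n : ℕ} {w : World (Res G (gwWalk (unifNat N))) n}
    (hd : SamplerSpec w c ι N d) {K₀ : Ectx} {D : Set ℕ}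
    (H : ∀ {n : ℕ} {w : World (Res G (gwWalk (unifNat N))) n} {h : ℕ → Option Val},
      (∀ l ∈ D, h l ≠ none) →
      SymWP w c ι N (gwState N 0) [] h (K₀.fill (val (.lit .unit))))
    {h : ℕ → Option Val} (hD : ∀ l ∈ D, h l ≠ none) {rs : List ℕ} (hs : StackInv d s h rs) :
    SymWP w c ι N (gwState N rs.length) [] h (K₀.fill (app (val run) (val (.lit (.loc s))))) := by
  have hload : ∀ v, (case (case (load (val (.lit (.loc s)))) none none' (some xP)
      (seq (store (val (.lit (.loc s))) (snd (var xP))) (some' (fst (var xP)))))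
      none tt (some xF) (seq (app (var xF) tt) (app (val run) v))).decomp =
      ([.case _ _ _ _, .case _ _ _ _], load (val (.lit (.loc s)))) := fun _ => rfl
  induction n generalizing h rs with
  | zero =>
    rcases rs with _ | ⟨r, rs⟩
    · exact .pureRun 2 (pureRun_run s) (.load (hload _) hs.1 (.pureRun 3 (pureRun_run_nil s) (H hD)))
    -- The model step places the remaining obligation under a later, which is trivial at index zero.
    · exact .presample (K₀.toVal_fill rfl) fun _ _ => trivial
  | succ n ih =>
    rcases rs with _ | ⟨r, rs⟩
    · exact .pureRun 2 (pureRun_run s) (.load (hload _) hs.1 (.pureRun 3 (pureRun_run_nil s) (H hD)))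
    · refine .presample (K₀.toVal_fill rfl) fun k => ?_
      -- Under the later the goal lives at index `n`, where the induction hypothesis is available
      -- for the next call of `run`.
      change SymWP w.lower c ι N (gwState N (rs.length + k)) [k] h _
      have hf : Future w w.lower := .step (Future.refl _)
      have hr := hs.2 r List.mem_cons_self
      refine .pureRun 2 (pureRun_run s) (.load (hload _) hs.1 ?_)
      refine .pureRun 2 (pureRun_run_cons s (task d s r) (rs.map (task d s)))
        (.store (l := s) (K := [.case _ _ _ _, .appR _]) rfl (by rw [hs.1]; exact nofun) ?_)
      refine .pureRun 5 (pureRun_run_some s (task d s r) _ _) (.focus (K := [.appR _])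
        (e₀ := app (val (task d s r)) tt) rfl (symWP_task hc (hd.future hf) (rs := rs)
          ⟨by simp, fun r' hr' => ?_⟩ (update_ne_none hr.1) hr.2 fun h' rs' hs' hl hh' => ?_))
      · have := hs.2 r' (List.mem_cons_of_mem _ hr')
        exact ⟨update_ne_none this.1, this.2⟩
      -- The walk is at `rs.length + k`, which is the length of the stack after the task has pushed
      -- its `k` children.
      · rw [Ectx.fill_append, ← hl]
        exact .pureRun 2 (pureRun_seq _ _)
          (ih (hd.future hf) (fun l hl => hh' l (update_ne_none (hD l hl))) hs')

/-- The initial stack holds the single task of the root, matching the walk's start at `1`. -/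
theorem symWP_genTree (hc : c * c = c) {n : ℕ} {w : World (Res G (gwWalk (unifNat N))) n}
    (hd : SamplerSpec w c ι N d) :
    SymWP w c ι N (gwState N 1) [] (fun _ => none) (app (val genTree) (val d)) := by
  change SymWP w c ι N (gwState N 1) [] (fun _ => none) (Ectx.fill [] _)
  refine .pureRun 2 (pureRun_genTree d) (.alloc (K := [.appR _]) rfl fun r _ => ?_)
  refine .pureRun 4 (pureRun_genTree_root d r) (.alloc (K := [.appR _]) rfl fun s hs => ?_)
  have hrs : r ≠ s := by
    rintro rfl
    simp at hs
  refine .pureRun 2 (pureRun_genTree_stack d r s) (.focus (K := [.appR _])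
    (e₀ := app (app (val stackAdd) (app (app (app (val sampleNode) (val d)) (val (.lit (.loc r))))
      (val (.lit (.loc s))))) (val (.lit (.loc s)))) rfl
    (symWP_addTask (rs := []) ⟨by simp [listVal], nofun⟩ (update_ne_none (by simp)) hrs
      fun h' hs' hh' => ?_))
  rw [Ectx.fill_append]
  refine .pureRun 2 (pureRun_seq _ _) (.focus (K := [.appR _])
    (e₀ := app (val run) (val (.lit (.loc s)))) rfl
    -- The program ends by reading the root reference `r`, so `r` has to remain allocated throughout
    -- the loop.
    (symWP_run hc hd (D := {r}) (fun {_ _ h} hr => ?_) ?_ hs'))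
  · rw [Ectx.fill_append]
    obtain ⟨v, hv⟩ := Option.ne_none_iff_exists'.1 (hr r rfl)
    exact .pureRun 2 (pureRun_seq _ _) (.load (K := []) rfl hv symWP_val)
  · rintro _ rfl
    exact hh' _ (update_ne_none (by simp))

theorem symRes_empty {C : MarkovChain} (m : C.State) (ks : List (Fin (N + 1))) :
    (symRes ι N (fun _ => none) ks m : Res G C) =
      (1, 1, 1, 1, .ofMap (Function.update (fun _ => none) () (some m)), 1) *
        (1, 1, 1, .ofMap (Function.update (fun _ => none) ι (some ⟨N, ks⟩)), 1, 1) := by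
  simp only [symRes, Prod.mk_mul_mk, one_mul, mul_one]
  rfl

/-- The triples in the hypothesis and in the conclusion are both boxed, so only the core of `a` is
available, and a core is idempotent as `symWP_run` requires. No heap ownership is assumed: the
program allocates all that it uses. -/
theorem hoare_genTree : samplerSpec G (gwWalk (unifNat N)) N ι d ⊢ₛ
    hoare (spec (gwState N 1) ∗ tape ι N []) (app (val genTree) (val d)) fun _ => pure True := by
  rintro n w a - h k w' b hw hv ⟨b₁, b₂, rfl, hb₁, hb₂⟩
  obtain ⟨f₁, rfl⟩ := spec_holds.1 hb₁
  obtain ⟨f₂, rfl⟩ := tape_holds.1 hb₂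
  have hd : SamplerSpec w' (RA.core a) ι N d := fun j => holds_future _ hw (h j)
  have hdvd := mul_dvd_mul_left (RA.core a) (dvd_mul_right (symRes ι N (fun _ => none) []
    (gwState N 1) : Res G (gwWalk (unifNat N))) (f₁ * f₂))
  rw [mul_mul_mul_comm, ← symRes_empty] at hv ⊢
  exact holds_dvd _ hdvd (symWP_genTree (RA.core_mul_core a) hd (RA.valid_of_dvd hdvd hv))

end

end GWLogic

theorem mainTheorem4 (G : Type) [RA G] (N ι : ℕ) (d : Val) :
    (samplerSpec G (gwWalk (unifNat N)) N ι d ⊢ₛ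
      hoare (spec (C := gwWalk (unifNat N)) (1 : ℕ) ∗ tape ι N [])
        (.app (.val genTree) (.val d)) (fun _ => IProp.pure True)) ∧
    ((IProp.pure True ⊢ₛ samplerSpec G (gwWalk (unifNat N)) N ι d) →
      ∀ σ : State, σ.tapes.lookup ι = some ⟨N, []⟩ →
        (gwWalk (unifNat N)).execTerm (1 : ℕ) ≤
          prog.execTerm (Expr.app (.val genTree) (.val d), σ)) := by
  refine ⟨hoare_genTree, fun hd σ hσ => ?_⟩
  -- The initial resource owns no heap entry, so it is compatible with any heap; it owns the empty
  -- tape `ι` and the model state.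
  have hv : RA.valid (authRes σ (gwState N 1) *
      (symRes ι N (fun _ => none) [] (gwState N 1) * 1) : Res G (gwWalk (unifNat N))) := by
    refine authRes_mul_symRes_valid.2 ⟨⟨RA.valid_one, RA.valid_one⟩, ?_, ?_, ?_, RA.valid_one⟩
    · exact AuthMap.valid_full_mul.2 ⟨rfl, fun l => .inr ⟨rfl, nofun, nofun⟩⟩
    · refine AuthMap.valid_full_mul.2 ⟨rfl, fun κ => ?_⟩
      rcases eq_or_ne κ ι with rfl | hκ
      · exact .inl ⟨⟨N, []⟩, by simp, hσ, rfl⟩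
      · exact .inr ⟨by simp [hκ], nofun, nofun⟩
    · exact AuthMap.valid_full_mul.2 ⟨rfl, fun _ => .inl ⟨gwState N 1, by simp, rfl, rfl⟩⟩
  rw [mul_one] at hv
  refine execTerm_le_of_rwp (m := gwState N 1) (Φ := fun _ => IProp.pure True) hv fun n => ?_
  -- A closed proof of the specification can be used with the unit resource, whose core is again the
  -- unit; thus nothing is left beside `symRes`.
  have hh := hoare_genTree n (emptyWorld _ n) 1 RA.valid_one (hd n _ 1 RA.valid_one trivial) n _
    (symRes ι N (fun _ => none) [] (gwState N 1)) (Future.refl _)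
  rw [RA.core_one, one_mul] at hh
  refine hh (RA.valid_mul_right hv) ⟨_, _, symRes_empty _ _, spec_holds.2 dvd_rfl,
    tape_holds.2 dvd_rfl⟩
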